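/- **Theorem.** The *Euler graph* has, at each level $n\le 0$, the vertices $0,1,\dots,|n|$. The vertex $v$ of level $n$ is joined to the vertex $v$ of level $n-1$ by $v+1$ edges and to the vertex $v+1$ of level $n-1$ by $|n|+1-v$ edges, and there are no other edges. Let $\Gamma$ be its space of infinite paths, that is, of sequences $(\gamma_n)_{n\le 0}$ of successively connected edges, $\gamma_n$ joining level $n-1$ to level $n$, with the $\sigma$-field induced by the product of the discrete edge sets. For each vertex of level $n<0$, label the edges joining it to level $n+1$ by pairwise distinct labels. For a random path with law $\mu$ let $G_n$ be its edge between levels $n-1$ and $n$, $V_n$ its vertex at level $n$, and $\varepsilon_n$ the label of $G_n$, seen as an edge from $V_{n-1}$ to level $n$. Let $\mathcal G_n=\sigma(G_m;\,m\le n)$ and $\mathcal G=(\mathcal G_n)_{n\le 0}$. Let $\mu$ be a probability measure on $\Gamma$ such that * $\mu$ is *ergodic*: every event of $\bigcap_{n\le 0}\mathcal G_n$ has $\mu$-probability $0$ or $1$; * for every $n\le 0$, $\mathcal L(\varepsilon_n\mid V_{n-1})=\mathcal L(\varepsilon_n\mid\mathcal G_{n-1})$ almost surely, that is, $\varepsilon_n$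 is conditionally independent of $\mathcal G_{n-1}$ given $V_{n-1}$. Then, up to isomorphism, $\mathcal G$ admits a generating parameterization, and hence $\mathcal G$ is standard. Here two filtrations, possibly on different probability spaces, are *isomorphic* if they are generated by two processes with the same law. A *parameterization* of a filtration $\mathcal F=(\mathcal F_n)_{n\le 0}$ is a sequence $(U_n)_{n\le 0}$ of random variables such that, for each $n\le 0$, $U_n$ is independent of $\mathcal F_{n-1}\vee\sigma(U_m;\,m\le n-1)$ and $\mathcal F_n\subset\mathcal F_{n-1}\vee\sigma(U_n)$. It is *generating* if $\mathcal F_n\subset\sigma(U_m;\,m\le n)$ for all $n\le 0$. A filtration $\mathcal F$ is *immersed* in $\mathcal H$ if $\mathcal F_n\subset\mathcal H_n$ for all $n\le 0$ and, for all $n<0$, $\mathcal F_{n+1}$ is conditionally independent of $\mathcal H_n$ given $\mathcal F_n$. A filtration is *standard* if some filtration isomorphic to it is immersed in a filtration generated by a sequence of independent random variables. -/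

import Mathlib

open MeasureTheory ProbabilityTheory OrderDual

universe u v

/-! ## Filtrations in discrete negative time

A filtration indexed by the nonpositive integers is a Mathlib filtration indexed by `ℕᵒᵈ`:
the natural number `k` stands for the time `-k`, so that `k + 1` is the time just before `k`. -/

/-- A filtration `(F_n)_{n ≤ 0}`; `F (toDual k)` is the sigma-field at time `-k`. -/
abbrev BackwardFiltration (Ω : Type u) [mΩ : MeasurableSpace Ω] := Filtration ℕᵒᵈ mΩ

/-- The filtration generated by a process `(X_n)_{n ≤ 0}` (`X k` is the variable at time `-k`):
at time `-k` it is generated by the variables `X m` with `-m ≤ -k`. -/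
def generatedFiltration {Ω : Type u} [MeasurableSpace Ω] {E : ℕ → Type v}
    [mE : ∀ k, MeasurableSpace (E k)] (X : ∀ k, Ω → E k) (hX : ∀ k, Measurable (X k)) :
    BackwardFiltration Ω where
  seq k := ⨆ m : ℕ, ⨆ _ : ofDual k ≤ m, (mE m).comap (X m)
  mono' _ _ hij := iSup_mono fun _ => iSup_mono' fun hm => ⟨le_trans hij hm, le_rfl⟩
  le' _ := iSup_le fun m => iSup_le fun _ => (hX m).comap_le

/-- The tail sigma-field at time `-∞` is degenerate. -/
def IsKolmogorovian {Ω : Type u} [MeasurableSpace Ω] (F : BackwardFiltration Ω)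
    (P : Measure Ω) : Prop :=
  ∀ A : Set Ω, MeasurableSet[⨅ k : ℕ, F (toDual k)] A → P A = 0 ∨ P A = 1

/-- The sigma-fields `m₁` and `m₂` are conditionally independent given `m'`. -/
def CondIndepSigma {Ω : Type u} (m' m₁ m₂ : MeasurableSpace Ω) {mΩ : MeasurableSpace Ω}
    (P : Measure Ω) : Prop :=
  ∀ A B : Set Ω, MeasurableSet[m₁] A → MeasurableSet[m₂] B →
    P⟦A ∩ B | m'⟧ =ᵐ[P] P⟦A | m'⟧ * P⟦B | m'⟧

/-- `F` is immersed in `G`: `F ⊆ G`, and for `n < 0` the sigma-field `F_{n+1}` is conditionally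
independent of `G_n` given `F_n` (here `n = -(k + 1)`). -/
def IsImmersed {Ω : Type u} [MeasurableSpace Ω] (F G : BackwardFiltration Ω)
    (P : Measure Ω) : Prop :=
  F ≤ G ∧ ∀ k : ℕ,
    CondIndepSigma (F (toDual (k + 1))) (F (toDual k)) (G (toDual (k + 1))) P

/-- Two filtrations (on possibly different probability spaces) are isomorphic: they are generated
by two processes which have the same law. -/
def IsIsomorphicFiltration {Ω Ω' : Type u} [MeasurableSpace Ω] [MeasurableSpace Ω']
    (F : BackwardFiltration Ω) (P : Measure Ω) (F' : BackwardFiltration Ω') (P' : Measure Ω') :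
    Prop :=
  ∃ (E : ℕ → Type u) (_ : ∀ k, MeasurableSpace (E k)) (X : ∀ k, Ω → E k) (X' : ∀ k, Ω' → E k)
    (hX : ∀ k, Measurable (X k)) (hX' : ∀ k, Measurable (X' k)),
    F = generatedFiltration X hX ∧ F' = generatedFiltration X' hX' ∧
      P.map (fun ω k => X k ω) = P'.map (fun ω k => X' k ω)

/-- A filtration of product type: generated by a sequence of independent (real-valued)
random variables. -/
def IsProductType {Ω : Type u} [MeasurableSpace Ω] (F : BackwardFiltration Ω)
    (P : Measure Ω) : Prop :=
  ∃ (U : ℕ → Ω → ℝ) (hU : ∀ k, Measurable (U k)),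
    iIndepFun U P ∧ F = generatedFiltration U hU

/-- A filtration is standard if, up to isomorphism, it is immersed in a filtration of
product type. -/
def IsStandardFiltration {Ω : Type u} [MeasurableSpace Ω] (F : BackwardFiltration Ω)
    (P : Measure Ω) : Prop :=
  ∃ (Ω' : Type u) (_ : MeasurableSpace Ω') (P' : Measure Ω') (_ : IsProbabilityMeasure P')
    (F' G' : BackwardFiltration Ω'),
    IsIsomorphicFiltration F P F' P' ∧ IsProductType G' P' ∧ IsImmersed F' G' P'

/-- `(U_n)_{n ≤ 0}` is a parameterization of `F`: each `U_n` is independent of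
`F_{n-1} ∨ σ(U_m; m ≤ n-1)` (so that the `U_n` are independent), and
`F_n ⊆ F_{n-1} ∨ σ(U_n)`. -/
def IsParameterization {Ω : Type u} [MeasurableSpace Ω] (F : BackwardFiltration Ω)
    (P : Measure Ω) (U : ℕ → Ω → ℝ) (hU : ∀ k, Measurable (U k)) : Prop :=
  ∀ k : ℕ,
    Indep (Real.measurableSpace.comap (U k))
      (F (toDual (k + 1)) ⊔ generatedFiltration U hU (toDual (k + 1))) P ∧
    F (toDual k) ≤ F (toDual (k + 1)) ⊔ Real.measurableSpace.comap (U k)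

/-- `F` admits, up to isomorphism, a generating parameterization: some copy `F'` of `F` has a
parameterization `U` whose filtration contains `F'`. -/
def AdmitsGeneratingParameterization {Ω : Type u} [MeasurableSpace Ω] (F : BackwardFiltration Ω)
    (P : Measure Ω) : Prop :=
  ∃ (Ω' : Type u) (_ : MeasurableSpace Ω') (P' : Measure Ω') (_ : IsProbabilityMeasure P')
    (F' : BackwardFiltration Ω') (U : ℕ → Ω' → ℝ) (hU : ∀ k, Measurable (U k)),
    IsIsomorphicFiltration F P F' P' ∧ IsParameterization F' P' U hU ∧
      F' ≤ generatedFiltration U hU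

/-! ## The Euler graph and its path space

The vertices at level `-k` are `0, …, k`, that is, `Fin (k + 1)`. -/

/-- The number of edges between the vertex `v` of level `-k` and the vertex `w` of level
`-(k + 1)`: `v + 1` if `w = v`, `k + 1 - v` if `w = v + 1`, and none otherwise. -/
def eulerMultiplicity (k : ℕ) (v : Fin (k + 1)) (w : Fin (k + 2)) : ℕ :=
  if (w : ℕ) = v then v + 1 else if (w : ℕ) = v + 1 then k + 1 - v else 0

/-- The edges between level `-(k + 1)` and level `-k`. -/
def EulerEdge (k : ℕ) : Type :=
  Σ (v : Fin (k + 1)) (w : Fin (k + 2)), Fin (eulerMultiplicity k v w)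

/-- The edge sets are finite and carry the discrete sigma-field. -/
instance (k : ℕ) : MeasurableSpace (EulerEdge k) := ⊤

/-- The end of an edge at level `-k`. -/
def EulerEdge.upper {k : ℕ} (e : EulerEdge k) : Fin (k + 1) := e.1

/-- The end of an edge at level `-(k + 1)`. -/
def EulerEdge.lower {k : ℕ} (e : EulerEdge k) : Fin (k + 2) := e.2.1

/-- The infinite paths: sequences of connected edges, one between any two consecutive levels,
starting at the only vertex of level `0`. -/
def EulerPath : Type :=
  {γ : ∀ k, EulerEdge k // ∀ k, (γ k).lower = (γ (k + 1)).upper}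

/-- The Borel structure of the path space, induced by the product. -/
instance : MeasurableSpace EulerPath :=
  inferInstanceAs (MeasurableSpace {γ : ∀ k, EulerEdge k // ∀ k, (γ k).lower = (γ (k + 1)).upper})

/-- The edge `G_n` of a path between the levels `n - 1` and `n`, where `n = -k`. -/
def EulerPath.edge (k : ℕ) (γ : EulerPath) : EulerEdge k := γ.1 k

/-- The vertex `V_n` of a path at level `n = -k`. -/
def EulerPath.vertex (k : ℕ) (γ : EulerPath) : Fin (k + 1) := (γ.edge k).upper

theorem EulerPath.measurable_edge (k : ℕ) : Measurable (EulerPath.edge k) :=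
  (measurable_pi_apply k).comp measurable_subtype_coe

/-- The filtration `𝒢` generated by the random path `(G_n)_{n ≤ 0}`. -/
def eulerFiltration : BackwardFiltration EulerPath :=
  generatedFiltration EulerPath.edge EulerPath.measurable_edge

/-- A labelling of the edges: for every vertex `w` at level `n < 0`, the edges which connect `w`
to level `n + 1` receive pairwise distinct labels. -/
def IsEdgeLabelling (lab : ∀ k, EulerEdge k → ℕ) : Prop :=
  ∀ (k : ℕ) (e e' : EulerEdge k), e.lower = e'.lower → lab k e = lab k e' → e = e'

/-- A probability measure on the path space is ergodic if the filtration `𝒢` is Kolmogorovian. -/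
def IsErgodicPathMeasure (μ : Measure EulerPath) : Prop :=
  IsKolmogorovian eulerFiltration μ

/-- `ℒ(ε_n | V_{n-1}) = ℒ(ε_n | 𝒢_{n-1})` for all `n ≤ 0`, where `ε_n` is the label of the
edge connecting `V_{n-1}` to `V_n` (here `n = -k`). -/
def LabelsCondIndep (lab : ∀ k, EulerEdge k → ℕ) (μ : Measure EulerPath) : Prop :=
  ∀ (k : ℕ) (s : Set ℕ),
    μ⟦{γ : EulerPath | lab k (γ.edge k) ∈ s} |
        (⊤ : MeasurableSpace (Fin (k + 2))).comap (EulerPath.vertex (k + 1))⟧ =ᵐ[μ]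
      μ⟦{γ : EulerPath | lab k (γ.edge k) ∈ s} | eulerFiltration (toDual (k + 1))⟧

/-! At every level, attach to each vertex a random edge towards the next level, drawn from the
conditional law of the path's edge there, independently over vertices and levels. At the vertex
actually visited, overwrite the drawn edge by the edge of the path. The resulting
`NoisyPath.innovation` is again a family of independent edges, and it is independent of the past of
path and noise (`LabelsCondIndep.indep_innovation`): this is the Markov property, which holds
because label and starting vertex determine the edge. The path follows the innovations, so they
parameterize its filtration; the question is whether they generate it.

The geometry of the graph enters through `EdgeSection.monotone_step`: one step keeps the vertex
number or lowers it by one, so trajectories driven by the same innovations never cross. Two ordered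
integer-valued variables differ with probability at most the difference of their means, hence
trajectories with close means at level `-k` coincide there with high probability
(`measureReal_vertexFrom_ne_le`). The mean, as a function of the vertex at level `-N`, evaluated
along the path, is the conditional expectation of the vertex at level `-k` given the past at `-N`
(`LabelsCondIndep.condExp_vertex`). By ergodicity and reverse martingale convergence it tends in L¹
to a constant. So a trajectory started far in the past at a well-chosen deterministic vertex merges
with the path with high probability.

By Borel–Cantelli, along a suitable sequence of starting points the path is almost surely a limit of
functions of the innovations. The limit is defined everywhere and equals the path only almost
surely; it therefore serves as the isomorphic copy, for which the inclusions of sigma-fields are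
exact. Standardness follows, since a generating parameterization provides an immersion into the
filtration of its independent variables. -/

open Filter Topology

/-! ## Reverse martingales of Kolmogorovian filtrations -/

/-- A set which at each time is almost surely equal to a past event has probability `0` or `1`. -/
theorem IsKolmogorovian.ae_mem_or_ae_notMem {Ω : Type u} [mΩ : MeasurableSpace Ω]
    {F : BackwardFiltration Ω} {P : Measure Ω} [IsProbabilityMeasure P]
    (hF : IsKolmogorovian F P) {s : Set Ω}
    (hs : ∀ k, ∃ t, MeasurableSet[F (toDual k)] t ∧ t =ᵐ[P] s) :
    (∀ᵐ ω ∂P, ω ∈ s) ∨ ∀ᵐ ω ∂P, ω ∉ s := by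
  choose t ht hts using hs
  have hlim : ∀ᵐ ω ∂P, ω ∈ limsup t atTop ↔ ω ∈ s := by
    have hall : ∀ᵐ ω ∂P, ∀ k, (ω ∈ t k ↔ ω ∈ s) := by
      refine ae_all_iff.2 fun k => ?_
      exact eventuallyEq_set.1 (hts k)
    filter_upwards [hall] with ω h
    rw [mem_limsup_iff_frequently_mem]
    simp [h]
  have hmeas : MeasurableSet[⨅ k : ℕ, F (toDual k)] (limsup t atTop) := by
    rw [MeasurableSpace.measurableSet_iInf]
    intro k
    -- Dropping the first `k` events does not change the limsup and leaves only events of the past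
    -- of `-k`; so the limsup is an exact tail event.
    rw [← limsup_nat_add t k]
    refine @MeasurableSet.measurableSet_limsup _ (F (toDual k)) _ fun n => ?_
    exact F.mono (toDual_le_toDual.2 (Nat.le_add_left k n)) _ (ht _)
  have hmeas' : MeasurableSet (limsup t atTop) :=
    (iInf_le_of_le (f := fun k : ℕ => F (toDual k)) 0 (F.le (toDual 0))) _ hmeas
  rcases hF _ hmeas with h | h
  · right
    have h0 : ∀ᵐ ω ∂P, ω ∉ limsup t atTop := measure_eq_zero_iff_ae_notMem.1 h
    filter_upwards [h0, hlim] with ω h1 h2 h3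
    exact h1 (h2.2 h3)
  · left
    have h0 : ∀ᵐ ω ∂P, ω ∈ limsup t atTop := (prob_compl_eq_zero_iff hmeas').2 h
    filter_upwards [h0, hlim] with ω h1 h2
    exact h2.1 h1

/-- Every Borel preimage has probability `0` or `1`, and countably many Borel sets separate the
reals. The measurable version of `f` may vary with `k`. -/
theorem IsKolmogorovian.ae_eq_const {Ω : Type u} [mΩ : MeasurableSpace Ω]
    {F : BackwardFiltration Ω} {P : Measure Ω} [IsProbabilityMeasure P]
    (hF : IsKolmogorovian F P) {f : Ω → ℝ}
    (hf : ∀ k, AEStronglyMeasurable[F (toDual k)] f P) :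
    ∃ c : ℝ, f =ᵐ[P] fun _ => c := by
  obtain ⟨c, hc⟩ := exists_eventuallyEq_const_of_forall_separating (l := ae P) (f := f)
    MeasurableSet fun U hU => hF.ae_mem_or_ae_notMem (s := f ⁻¹' U) fun k => by
      obtain ⟨g, hg, hfg⟩ := hf k
      refine ⟨g ⁻¹' U, hg.measurable hU, ?_⟩
      refine eventuallyEq_set.2 ?_
      filter_upwards [hfg] with ω h
      rw [Set.mem_preimage, Set.mem_preimage, h]
  exact ⟨c, hc⟩

/-- Reverse martingale convergence in `L¹`. -/
theorem IsKolmogorovian.tendsto_integral_abs_condExp_sub {Ω : Type u} [mΩ : MeasurableSpace Ω]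
    {F : BackwardFiltration Ω} {P : Measure Ω} [IsProbabilityMeasure P]
    (hF : IsKolmogorovian F P) {f : Ω → ℝ} (hf : MemLp f 2 P) :
    Tendsto (fun k : ℕ => ∫ ω, |(P[f | F (toDual k)]) ω - ∫ ω', f ω' ∂P| ∂P) atTop (𝓝 0) := by
  have : ∀ k : ℕ, Fact (F (toDual k) ≤ mΩ) := fun k => ⟨F.le _⟩
  let K : ℕ → Submodule ℝ (Lp ℝ 2 P) := fun k => lpMeas ℝ ℝ (F (toDual k)) 2 P
  have hK : Antitone K := fun i j hij x hx => by
    simp only [K, mem_lpMeas_iff_aestronglyMeasurable] at hx ⊢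
    exact hx.mono (F.mono (toDual_le_toDual.2 hij))
  have hKc : ∀ k, IsClosed (K k : Set (Lp ℝ 2 P)) := fun k => by
    have := isClosed_aestronglyMeasurable (F := ℝ) (p := 2) (μ := P) (F.le (toDual k))
    exact this
  have : ∀ k, (K k).HasOrthogonalProjection := fun k => by
    have := (hKc k).completeSpace_coe
    infer_instance
  let x : Lp ℝ 2 P := hf.toLp f
  -- The subspaces `K k` decrease, so convergence of the projections is read off their increasing
  -- orthogonal complements.
  have hconv := Submodule.starProjection_tendsto_closure_iSup (fun k => (K k)ᗮ)
    (fun i j hij => Submodule.orthogonal_le (hK hij)) x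
  obtain ⟨y, hy⟩ : ∃ y, Tendsto (fun k => (K k).starProjection x) atTop (𝓝 y) := by
    refine ⟨_, (hconv.const_sub x).congr fun k => ?_⟩
    simp [Submodule.starProjection_orthogonal]
  have hyK : ∀ k, y ∈ K k := fun k => by
    refine (hKc k).mem_of_tendsto hy ?_
    filter_upwards [eventually_ge_atTop k] with n hn
    exact hK hn (Submodule.starProjection_apply_mem _ _)
  obtain ⟨c, hc⟩ := hF.ae_eq_const (f := y) fun k =>
    mem_lpMeas_iff_aestronglyMeasurable.1 (hyK k)
  have hproj : ∀ k, ((K k).starProjection x : Ω → ℝ) =ᵐ[P] P[f | F (toDual k)] := fun k =>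
    hf.condExpL2_ae_eq_condExp (𝕜 := ℝ) (F.le (toDual k))
  have hint : ∀ k : ℕ, Integrable (P[f | F (toDual k)]) P := fun k => integrable_condExp
  have hL1 : Tendsto (fun k : ℕ => ∫ ω, |(P[f | F (toDual k)]) ω - c| ∂P) atTop (𝓝 0) := by
    have hn : Tendsto (fun k => ‖(K k).starProjection x - y‖) atTop (𝓝 0) :=
      tendsto_iff_norm_sub_tendsto_zero.1 hy
    refine squeeze_zero (fun k => integral_nonneg fun _ => abs_nonneg _) (fun k => ?_) hn
    have hae : (fun ω => |(P[f | F (toDual k)]) ω - c|)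
        =ᵐ[P] fun ω => ‖((K k).starProjection x - y : Lp ℝ 2 P) ω‖ := by
      filter_upwards [hproj k, hc, Lp.coeFn_sub ((K k).starProjection x) y] with ω h1 h2 h3
      rw [h3, Pi.sub_apply, h1, h2, Real.norm_eq_abs]
    rw [integral_congr_ae hae, Lp.norm_def,
      integral_norm_eq_lintegral_enorm (Lp.aestronglyMeasurable _), ← eLpNorm_one_eq_lintegral_enorm]
    refine ENNReal.toReal_mono (Lp.eLpNorm_ne_top _) ?_
    exact eLpNorm_le_eLpNorm_of_exponent_le (by norm_num) (Lp.aestronglyMeasurable _)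
  -- Conditional expectations preserve the mean, which identifies the constant limit.
  have hcf : c = ∫ ω, f ω ∂P := by
    have hle : ∀ k : ℕ, |(∫ ω, f ω ∂P) - c| ≤ ∫ ω, |(P[f | F (toDual k)]) ω - c| ∂P := fun k => by
      have h1 : (∫ ω, f ω ∂P) - c = ∫ ω, ((P[f | F (toDual k)]) ω - c) ∂P := by
        rw [integral_sub (hint k) (integrable_const c), integral_condExp (F.le _)]
        simp
      rw [h1]
      exact abs_integral_le_integral_abs
    have := le_of_tendsto_of_tendsto' tendsto_const_nhds hL1 hle
    have h0 := abs_eq_zero.1 (le_antisymm this (abs_nonneg _))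
    linarith
  rwa [hcf] at hL1

/-! ## Independence -/

section Independence

variable {Ω : Type u} [mΩ : MeasurableSpace Ω] {P : Measure Ω} [IsProbabilityMeasure P]

theorem isPiSystem_image2_inter {α : Type*} {s t : Set (Set α)} (hs : IsPiSystem s)
    (ht : IsPiSystem t) : IsPiSystem (Set.image2 (· ∩ ·) s t) := by
  rintro _ ⟨a, ha, b, hb, rfl⟩ _ ⟨c, hc, d, hd, rfl⟩ hne
  have hne' : ((a ∩ c) ∩ (b ∩ d)).Nonempty := by rwa [Set.inter_inter_inter_comm]
  exact ⟨a ∩ c, hs a ha c hc hne'.left, b ∩ d, ht b hb d hd hne'.right,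
    (Set.inter_inter_inter_comm a b c d).symm⟩

theorem MeasurableSpace.sup_eq_generateFrom_image2_inter {α : Type*} (m n : MeasurableSpace α) :
    m ⊔ n = MeasurableSpace.generateFrom
      (Set.image2 (· ∩ ·) {s | MeasurableSet[m] s} {s | MeasurableSet[n] s}) := by
  refine le_antisymm (sup_le (fun s hs => ?_) fun s hs => ?_) (MeasurableSpace.generateFrom_le ?_)
  · exact MeasurableSpace.measurableSet_generateFrom
      ⟨s, hs, Set.univ, MeasurableSet.univ, Set.inter_univ s⟩
  · exact MeasurableSpace.measurableSet_generateFrom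
      ⟨Set.univ, MeasurableSet.univ, s, hs, Set.univ_inter s⟩
  · rintro _ ⟨a, ha, b, hb, rfl⟩
    exact MeasurableSet.inter ((le_sup_left : m ≤ m ⊔ n) _ ha) ((le_sup_right : n ≤ m ⊔ n) _ hb)

/-- If each `m k` is independent of `H (k + 1)`, where `m k ≤ H k` and `H` decreases, then
`m 0, …, m (N - 1), H N` behave independently. -/
theorem indep_iSup_lt_of_indep_succ {m H : ℕ → MeasurableSpace Ω} (hmH : ∀ k, m k ≤ H k)
    (hH : Antitone H) (hle : ∀ k, H k ≤ mΩ) (hind : ∀ k, Indep (m k) (H (k + 1)) P) (N : ℕ) :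
    Indep (⨆ k, ⨆ _ : k < N, m k) (H N) P := by
  induction N with
  | zero => simpa using indep_bot_left (H 0)
  | succ N ih =>
    have hsup : (⨆ k, ⨆ _ : k < N + 1, m k) = (⨆ k, ⨆ _ : k < N, m k) ⊔ m N := by
      rw [Nat.iSup_lt_succ]
    have hA : (⨆ k, ⨆ _ : k < N, m k) ≤ mΩ := iSup₂_le fun k _ => (hmH k).trans (hle k)
    rw [hsup]
    refine IndepSets.indep (sup_le hA ((hmH N).trans (hle N))) (hle (N + 1))
      (p1 := Set.image2 (· ∩ ·) {s | MeasurableSet[⨆ k, ⨆ _ : k < N, m k] s}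
        {s | MeasurableSet[m N] s}) (p2 := {s | MeasurableSet[H (N + 1)] s})
      ?_ (@MeasurableSpace.isPiSystem_measurableSet _ (H (N + 1))) ?_
      (@MeasurableSpace.generateFrom_measurableSet _ (H (N + 1))).symm ?_
    · exact isPiSystem_image2_inter
        (@MeasurableSpace.isPiSystem_measurableSet _ (⨆ k, ⨆ _ : k < N, m k))
        (@MeasurableSpace.isPiSystem_measurableSet _ (m N))
    · exact MeasurableSpace.sup_eq_generateFrom_image2_inter _ _
    · refine (IndepSets_iff _ _ _).2 ?_
      rintro _ C ⟨a, ha, b, hb, rfl⟩ hC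
      have hC' : MeasurableSet[H N] C := hH (Nat.le_succ N) _ hC
      have h1 := (Indep_iff _ _ _).1 ih a (b ∩ C) ha (MeasurableSet.inter (hmH N _ hb) hC')
      have h2 := (Indep_iff _ _ _).1 (hind N) b C hb hC
      have h3 := (Indep_iff _ _ _).1 ih a b ha (hmH N _ hb)
      rw [Set.inter_assoc, h1, h2, h3, mul_assoc]

/-- The smallest index `a`, the latest time, is split off: all other events lie in `H (a + 1)`. -/
theorem iIndep_of_indep_succ {m H : ℕ → MeasurableSpace Ω} (hmH : ∀ k, m k ≤ H k)
    (hH : Antitone H) (hind : ∀ k, Indep (m k) (H (k + 1)) P) : iIndep m P := by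
  rw [iIndep_iff]
  intro s
  induction s using Finset.induction_on_min with
  | empty => simp
  | insert a s ha ih =>
    intro f hf
    have has : a ∉ s := fun h => lt_irrefl a (ha a h)
    rw [Finset.set_biInter_insert, Finset.prod_insert has,
      ← ih fun i hi => hf i (Finset.mem_insert_of_mem hi)]
    refine (Indep_iff _ _ _).1 (hind a) _ _ (hf a (Finset.mem_insert_self _ _)) ?_
    refine Finset.measurableSet_biInter s fun i hi => ?_
    exact (hmH i).trans (hH (ha i hi)) _ (hf i (Finset.mem_insert_of_mem hi))

end Independence

/-! ## Immersion of a parameterized filtration -/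

/-- If `n` is independent of `g` and `m ≤ g`, every sub-sigma-field of `m ⊔ n` is conditionally
independent of `g` given `m`. -/
theorem condIndepSigma_of_indep {Ω : Type u} {m g n a : MeasurableSpace Ω}
    [mΩ : MeasurableSpace Ω] {P : Measure Ω} [IsProbabilityMeasure P] (hmg : m ≤ g) (hg : g ≤ mΩ)
    (hn : n ≤ mΩ) (hind : Indep n g P) (ha : a ≤ m ⊔ n) : CondIndepSigma m a g P := by
  intro A B hA hB
  have hm : m ≤ mΩ := hmg.trans hg
  have hmn : m ⊔ n ≤ mΩ := sup_le hm hn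
  have hA' : MeasurableSet[m ⊔ n] A := ha _ hA
  have hBm : MeasurableSet B := hg _ hB
  have hBi : Integrable (B.indicator fun _ => (1 : ℝ)) P := (integrable_const 1).indicator hBm
  -- Since `n` is independent of `g`, adding it to `m` gives no information on `B`. The claim then
  -- follows by conditioning on `m ⊔ n`, which contains `A`, and then on `m`.
  have hkey : P⟦B | m ⊔ n⟧ =ᵐ[P] P⟦B | m⟧ := by
    refine (ae_eq_condExp_of_forall_setIntegral_eq hmn hBi
      (fun _ _ _ => integrable_condExp.integrableOn) (fun s hs _ => ?_)
      (@StronglyMeasurable.aestronglyMeasurable _ _ _ (m ⊔ n) mΩ _ _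
        (stronglyMeasurable_condExp.mono le_sup_left))).symm
    refine MeasurableSpace.induction_on_inter (m := m ⊔ n)
      (C := fun s _ => ∫ ω in s, (P⟦B | m⟧) ω ∂P = ∫ ω in s, B.indicator (fun _ => (1 : ℝ)) ω ∂P)
      (s := Set.image2 (· ∩ ·) {s | MeasurableSet[m] s} {s | MeasurableSet[n] s})
      (MeasurableSpace.sup_eq_generateFrom_image2_inter m n)
      (isPiSystem_image2_inter (@MeasurableSpace.isPiSystem_measurableSet _ m)
        (@MeasurableSpace.isPiSystem_measurableSet _ n)) (by simp) ?_ ?_ ?_ s hs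
    · rintro _ ⟨s, hs, t, ht, rfl⟩
      have hs' : MeasurableSet s := hm _ hs
      have hfac : ∀ f : Ω → ℝ, StronglyMeasurable[g] f → Integrable f P →
          ∫ ω in s ∩ t, f ω ∂P = P.real t * ∫ ω in s, f ω ∂P := fun f hf hfi => by
        rw [Set.inter_comm, ← integral_indicator hs', ← setIntegral_indicator hs']
        rw [← setIntegral_condExp hn (hfi.indicator hs') ht,
          setIntegral_congr_ae (hn _ ht) ((condExp_indep_eq hg hn (hf.indicator (hmg _ hs))
            hind.symm).mono fun _ h _ => h)]
        simp
      rw [hfac _ (stronglyMeasurable_condExp.mono hmg) integrable_condExp,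
        hfac _ ((@stronglyMeasurable_const _ _ g _ 1).indicator hB) hBi,
        setIntegral_condExp hm hBi hs]
    · intro s hs h
      have h1 := integral_add_compl (hmn _ hs)
        (integrable_condExp (f := B.indicator fun _ => (1 : ℝ)) (m := m) (μ := P))
      have h2 := integral_add_compl (hmn _ hs) hBi
      rw [integral_condExp hm] at h1
      linarith
    · intro f hd hf h
      rw [integral_iUnion (fun i => hmn _ (hf i)) hd integrable_condExp.integrableOn,
        integral_iUnion (fun i => hmn _ (hf i)) hd hBi.integrableOn]
      exact tsum_congr h
  have hAm : MeasurableSet A := hmn _ hA'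
  have hAi : Integrable (A.indicator fun _ => (1 : ℝ)) P := (integrable_const 1).indicator hAm
  have hprod : (A ∩ B).indicator (fun _ => (1 : ℝ))
      = A.indicator (fun _ => (1 : ℝ)) * B.indicator fun _ => (1 : ℝ) := by
    ext ω
    by_cases h1 : ω ∈ A <;> by_cases h2 : ω ∈ B <;> simp [h1, h2]
  have hABi : Integrable (A.indicator (fun _ => (1 : ℝ)) * B.indicator fun _ => (1 : ℝ)) P := by
    rw [← hprod]
    exact (integrable_const 1).indicator (hAm.inter hBm)
  have hpull : P[A.indicator (fun _ => (1 : ℝ)) * B.indicator (fun _ => (1 : ℝ)) | m ⊔ n]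
      =ᵐ[P] A.indicator (fun _ => (1 : ℝ)) * P⟦B | m⟧ :=
    (condExp_mul_of_stronglyMeasurable_left
      ((@stronglyMeasurable_const _ _ (m ⊔ n) _ 1).indicator hA')
      hABi hBi).trans ((EventuallyEq.refl _ _).mul hkey)
  have hAB : Integrable (A.indicator (fun _ => (1 : ℝ)) * P⟦B | m⟧) P :=
    integrable_condExp.congr hpull
  rw [hprod]
  calc P[A.indicator (fun _ => (1 : ℝ)) * B.indicator (fun _ => (1 : ℝ)) | m]
      =ᵐ[P] P[P[A.indicator (fun _ => (1 : ℝ)) * B.indicator (fun _ => (1 : ℝ)) | m ⊔ n] | m] :=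
        (condExp_condExp_of_le le_sup_left hmn).symm
    _ =ᵐ[P] P[A.indicator (fun _ => (1 : ℝ)) * P⟦B | m⟧ | m] := condExp_congr_ae hpull
    _ =ᵐ[P] P⟦A | m⟧ * P⟦B | m⟧ :=
        condExp_mul_of_stronglyMeasurable_right stronglyMeasurable_condExp hAB hAi

/-! ## Measurability of the paths -/

instance (k : ℕ) : DiscreteMeasurableSpace (EulerEdge k) := ⟨fun _ => trivial⟩

instance (k : ℕ) : Finite (EulerEdge k) :=
  inferInstanceAs (Finite (Σ (v : Fin (k + 1)) (w : Fin (k + 2)), Fin (eulerMultiplicity k v w)))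

theorem EulerPath.lower_edge (k : ℕ) (γ : EulerPath) :
    (γ.edge k).lower = γ.vertex (k + 1) := γ.2 k

theorem EulerPath.measurable_vertex (k : ℕ) : Measurable (EulerPath.vertex k) :=
  (measurable_from_top (f := EulerEdge.upper)).comp (EulerPath.measurable_edge k)

theorem EulerEdge.lower_eq_or (k : ℕ) (e : EulerEdge k) :
    (e.lower : ℕ) = e.upper ∨ (e.lower : ℕ) = e.upper + 1 := by
  obtain ⟨v, w, i⟩ := e
  change (w : ℕ) = v ∨ (w : ℕ) = v + 1
  by_contra! h
  have hi := i.2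
  simp [eulerMultiplicity, h.1, h.2] at hi

section GeneratedFiltration

variable {Ω : Type u} [MeasurableSpace Ω] {E : ℕ → Type v} [mE : ∀ k, MeasurableSpace (E k)]
  {X : ∀ k, Ω → E k} (hX : ∀ k, Measurable (X k))

theorem comap_le_generatedFiltration {k m : ℕ} (h : k ≤ m) :
    (mE m).comap (X m) ≤ generatedFiltration X hX (toDual k) :=
  le_iSup₂_of_le (f := fun m (_ : k ≤ m) => (mE m).comap (X m)) m h le_rfl

theorem measurable_generatedFiltration {k m : ℕ} (h : k ≤ m) :
    Measurable[generatedFiltration X hX (toDual k)] (X m) :=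
  measurable_iff_comap_le.2 (comap_le_generatedFiltration hX h)

end GeneratedFiltration

theorem generatedFiltration_le_iff {Ω : Type u} {m : MeasurableSpace Ω} [MeasurableSpace Ω]
    {E : ℕ → Type v} [mE : ∀ k, MeasurableSpace (E k)] {X : ∀ k, Ω → E k}
    (hX : ∀ k, Measurable (X k)) {k : ℕ} :
    generatedFiltration X hX (toDual k) ≤ m ↔ ∀ j, k ≤ j → (mE j).comap (X j) ≤ m :=
  iSup₂_le_iff

theorem EulerPath.measurable_vertex_eulerFiltration {k m : ℕ} (h : k ≤ m) :
    Measurable[eulerFiltration (toDual k)] (EulerPath.vertex m) :=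
  (measurable_from_top (f := EulerEdge.upper)).comp
    (measurable_generatedFiltration EulerPath.measurable_edge h)

/-! ## The transition probabilities -/

/-- The edges between level `-(k + 1)` and level `-k` which start at the vertex `w`. -/
abbrev EulerEdge.From (k : ℕ) (w : Fin (k + 2)) : Type := {e : EulerEdge k // e.lower = w}

instance (k : ℕ) (w : Fin (k + 2)) : Nonempty (EulerEdge.From k w) := by
  rcases Nat.lt_or_ge (w : ℕ) (k + 1) with h | h
  · exact ⟨⟨⟨⟨w, h⟩, w, ⟨0, by simp [eulerMultiplicity]⟩⟩, rfl⟩⟩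
  -- The last vertex has no namesake at level `-k`; its only edge comes from the vertex `k`.
  · have hw : (w : ℕ) = k + 1 := by omega
    exact ⟨⟨⟨⟨k, by omega⟩, w, ⟨0, by simp [eulerMultiplicity, hw]⟩⟩, rfl⟩⟩

open Classical in
/-- The edge of a path between level `-(k + 1)` and level `-k`, if it starts at `w`. -/
noncomputable def EulerPath.edgeFrom (k : ℕ) (w : Fin (k + 2)) (γ : EulerPath) :
    EulerEdge.From k w :=
  if h : (γ.edge k).lower = w then ⟨γ.edge k, h⟩ else Classical.arbitrary _

theorem EulerPath.measurable_edgeFrom (k : ℕ) (w : Fin (k + 2)) :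
    Measurable (EulerPath.edgeFrom k w) := by
  classical
  exact (measurable_from_top (f := fun e : EulerEdge k =>
    if h : e.lower = w then (⟨e, h⟩ : EulerEdge.From k w) else Classical.arbitrary _)).comp
    (EulerPath.measurable_edge k)

open Classical in
/-- The conditional law of the edge of a random path from level `-(k + 1)`, given that it starts
at `w`; if this has probability zero, an arbitrary probability measure. -/
noncomputable def edgeLaw (μ : Measure EulerPath) (k : ℕ) (w : Fin (k + 2)) :
    Measure (EulerEdge.From k w) :=
  (if μ (EulerPath.vertex (k + 1) ⁻¹' {w}) = 0 then μ
    else μ[|EulerPath.vertex (k + 1) ⁻¹' {w}]).map (EulerPath.edgeFrom k w)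

instance (μ : Measure EulerPath) [IsProbabilityMeasure μ] (k : ℕ) (w : Fin (k + 2)) :
    IsProbabilityMeasure (edgeLaw μ k w) := by
  unfold edgeLaw
  split_ifs with h
  · exact Measure.isProbabilityMeasure_map (EulerPath.measurable_edgeFrom k w).aemeasurable
  · have := cond_isProbabilityMeasure h
    exact Measure.isProbabilityMeasure_map (EulerPath.measurable_edgeFrom k w).aemeasurable

/-- At a vertex of probability zero both sides vanish, so the arbitrary choice in `edgeLaw` is
harmless. -/
theorem measure_edge_preimage_eq (μ : Measure EulerPath) [IsProbabilityMeasure μ] (k : ℕ)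
    (w : Fin (k + 2)) (e : EulerEdge.From k w) :
    μ (EulerPath.edge k ⁻¹' {e.1})
      = μ (EulerPath.vertex (k + 1) ⁻¹' {w}) * edgeLaw μ k w {e} := by
  have hsub : EulerPath.edge k ⁻¹' {e.1} ⊆ EulerPath.vertex (k + 1) ⁻¹' {w} := by
    intro γ hγ
    have hγ' : γ.edge k = e.1 := hγ
    change γ.vertex (k + 1) = w
    rw [← γ.lower_edge, hγ', e.2]
  have hw := EulerPath.measurable_vertex (k + 1) (MeasurableSet.singleton w)
  by_cases h : μ (EulerPath.vertex (k + 1) ⁻¹' {w}) = 0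
  · rw [h, zero_mul]
    exact measure_mono_null hsub h
  · rw [edgeLaw, if_neg h, Measure.map_apply (EulerPath.measurable_edgeFrom k w)
      (MeasurableSet.singleton e), cond_apply hw, ← mul_assoc,
      ENNReal.mul_inv_cancel h (measure_ne_top _ _), one_mul]
    congr 1
    ext γ
    constructor
    · intro hγ
      refine ⟨hsub hγ, ?_⟩
      have hγ' : γ.edge k = e.1 := hγ
      have hl : (γ.edge k).lower = w := by rw [hγ', e.2]
      change γ.edgeFrom k w = e
      rw [EulerPath.edgeFrom, dif_pos hl]
      exact Subtype.ext hγ'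
    · rintro ⟨h1, h2⟩
      have hl : (γ.edge k).lower = w := (γ.lower_edge k).trans h1
      change γ.edgeFrom k w = e at h2
      rw [EulerPath.edgeFrom, dif_pos hl] at h2
      change γ.edge k = e.1
      rw [← h2]

/-- The Markov property. -/
theorem LabelsCondIndep.measure_inter_edge {lab : ∀ k, EulerEdge k → ℕ}
    (hlab : IsEdgeLabelling lab) {μ : Measure EulerPath} [IsProbabilityMeasure μ]
    (hind : LabelsCondIndep lab μ) (k : ℕ) (w : Fin (k + 2)) (e : EulerEdge.From k w)
    {B : Set EulerPath} (hB : MeasurableSet[eulerFiltration (toDual (k + 1))] B) :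
    μ (B ∩ EulerPath.edge k ⁻¹' {e.1})
      = μ (B ∩ EulerPath.vertex (k + 1) ⁻¹' {w}) * edgeLaw μ k w {e} := by
  set W : Set EulerPath := EulerPath.vertex (k + 1) ⁻¹' {w} with hW
  set L : Set EulerPath := {γ | lab k (γ.edge k) ∈ ({lab k e.1} : Set ℕ)} with hL
  have hVm := EulerPath.measurable_vertex (k + 1)
  have hWm : MeasurableSet W := hVm (MeasurableSet.singleton w)
  have hLm : MeasurableSet L :=
    ((measurable_from_top (f := lab k)).comp (EulerPath.measurable_edge k))
      (MeasurableSet.singleton (lab k e.1))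
  -- Labels are distinct among the edges from `w`, so the label and the vertex determine the edge.
  have hedge : EulerPath.edge k ⁻¹' {e.1} = L ∩ W := by
    ext γ
    constructor
    · intro h
      have h' : γ.edge k = e.1 := h
      refine ⟨?_, ?_⟩
      · change lab k (γ.edge k) = lab k e.1
        rw [h']
      · change γ.vertex (k + 1) = w
        rw [← γ.lower_edge, h', e.2]
    · rintro ⟨h1, h2⟩
      exact hlab k _ _ (((γ.lower_edge k).trans h2).trans e.2.symm) h1
  have hLi : Integrable (L.indicator fun _ => (1 : ℝ)) μ := (integrable_const 1).indicator hLm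
  -- The conditional probability given the vertex is a function `φ` of it, hence constant on `W`.
  -- The case `C = Set.univ` below identifies `φ w` with the mass of `e` under `edgeLaw`.
  obtain ⟨φ, -, hφ⟩ := (stronglyMeasurable_condExp (f := L.indicator fun _ => (1 : ℝ))
    (m := (⊤ : MeasurableSpace (Fin (k + 2))).comap (EulerPath.vertex (k + 1)))
    (μ := μ)).measurable.exists_eq_measurable_comp
  have hconst : ∀ C : Set EulerPath, MeasurableSet[eulerFiltration (toDual (k + 1))] C →
      μ.real (C ∩ (L ∩ W)) = μ.real (C ∩ W) * φ w := by
    intro C hC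
    have hCW : MeasurableSet[eulerFiltration (toDual (k + 1))] (C ∩ W) :=
      MeasurableSet.inter hC
        (EulerPath.measurable_vertex_eulerFiltration le_rfl (MeasurableSet.singleton w))
    have hCW' := eulerFiltration.le _ _ hCW
    have h1 := setIntegral_condExp (eulerFiltration.le (toDual (k + 1))) hLi hCW
    have h2 : ∫ γ in C ∩ W, (μ[L.indicator fun _ => (1 : ℝ) | eulerFiltration (toDual (k + 1))]) γ ∂μ
        = ∫ γ in C ∩ W, φ w ∂μ := by
      refine setIntegral_congr_ae hCW' ?_
      filter_upwards [hind k {lab k e.1}] with γ h hγ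
      rw [← h, hφ, Function.comp_apply, show γ.vertex (k + 1) = w from hγ.2]
    rw [h2, setIntegral_const, setIntegral_indicator hLm, setIntegral_const] at h1
    simp only [smul_eq_mul, mul_one] at h1
    rw [h1, Set.inter_comm L, Set.inter_assoc]
  have hBm := eulerFiltration.le _ _ hB
  have h1 := hconst B hB
  have h2 := hconst Set.univ MeasurableSet.univ
  rw [Set.univ_inter, Set.univ_inter, ← hedge] at h2
  rw [← hedge] at h1
  have h3 := congrArg ENNReal.toReal (measure_edge_preimage_eq μ k w e)
  rw [ENNReal.toReal_mul] at h3
  by_cases h0 : μ W = 0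
  · have : μ (B ∩ W) = 0 := measure_mono_null Set.inter_subset_right h0
    rw [this, zero_mul, hedge]
    exact measure_mono_null (fun γ hγ => hγ.2.2) h0
  · have h0' : μ.real W ≠ 0 := fun h => h0 ((measureReal_eq_zero_iff).1 h)
    have hq : φ w = (edgeLaw μ k w {e}).toReal :=
      mul_left_cancel₀ h0' (h2.symm.trans h3)
    rw [← ENNReal.toReal_eq_toReal_iff' (measure_ne_top _ _)
      (ENNReal.mul_ne_top (measure_ne_top _ _) (measure_ne_top _ _)), ENNReal.toReal_mul, ← hq]
    exact h1

/-! ## The innovations -/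

/-- A choice of an edge from each vertex of level `-(k + 1)`. -/
abbrev EdgeSection (k : ℕ) : Type := ∀ w : Fin (k + 2), EulerEdge.From k w

/-- The section `s` with its value at the start of `e` changed to `e`. -/
def EdgeSection.replace {k : ℕ} (e : EulerEdge k) (s : EdgeSection k) : EdgeSection k :=
  Function.update s e.lower ⟨e, rfl⟩

/-- A path together with independent noise. -/
abbrev NoisyPath : Type := EulerPath × ∀ k, EdgeSection k

/-- The edges chosen at random from each vertex, corrected so that they follow the path. -/
def NoisyPath.innovation (k : ℕ) (p : NoisyPath) : EdgeSection k :=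
  EdgeSection.replace (p.1.edge k) (p.2 k)

/-- This is the purpose of the correction: the path is a trajectory of the innovations, surely and
not only almost surely. -/
theorem NoisyPath.innovation_vertex (k : ℕ) (p : NoisyPath) :
    (p.innovation k (p.1.vertex (k + 1))).1 = p.1.edge k := by
  rw [← p.1.lower_edge]
  simp [NoisyPath.innovation, EdgeSection.replace]

/-- The law of the noise. -/
noncomputable def noiseLaw (μ : Measure EulerPath) [IsProbabilityMeasure μ] :
    Measure (∀ k, EdgeSection k) :=
  Measure.infinitePi fun k => Measure.pi (edgeLaw μ k)

instance (μ : Measure EulerPath) [IsProbabilityMeasure μ] : IsProbabilityMeasure (noiseLaw μ) := by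
  unfold noiseLaw
  infer_instance

theorem measurable_edgeSection_eval (k : ℕ) :
    Measurable (fun ω : ∀ k, EdgeSection k => ω k) := measurable_pi_apply k

theorem NoisyPath.measurable_innovation_of_le {m : MeasurableSpace NoisyPath} {k : ℕ}
    (h₁ : Measurable[m] fun p : NoisyPath => p.1.edge k)
    (h₂ : Measurable[m] fun p : NoisyPath => p.2 k) :
    Measurable[m] (NoisyPath.innovation k) :=
  (measurable_of_countable fun x : EulerEdge k × EdgeSection k =>
    EdgeSection.replace x.1 x.2).comp (h₁.prodMk h₂)

theorem NoisyPath.measurable_innovation (k : ℕ) : Measurable (NoisyPath.innovation k) :=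
  NoisyPath.measurable_innovation_of_le ((EulerPath.measurable_edge k).comp measurable_fst)
    ((measurable_edgeSection_eval k).comp measurable_snd)

/-- The filtration of the path and the noise. -/
@[reducible]
def noisyFiltration (k : ℕ) : MeasurableSpace NoisyPath :=
  (eulerFiltration (toDual k)).comap Prod.fst ⊔
    (generatedFiltration (fun k (ω : ∀ k, EdgeSection k) => ω k)
      measurable_edgeSection_eval (toDual k)).comap Prod.snd

theorem noisyFiltration_le (k : ℕ) : noisyFiltration k ≤ (inferInstance : MeasurableSpace NoisyPath) :=
  sup_le_sup (MeasurableSpace.comap_mono (eulerFiltration.le _))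
    (MeasurableSpace.comap_mono ((generatedFiltration _ measurable_edgeSection_eval).le _))

theorem antitone_noisyFiltration : Antitone noisyFiltration := fun _ _ h =>
  sup_le_sup (MeasurableSpace.comap_mono (eulerFiltration.mono (toDual_le_toDual.2 h)))
    (MeasurableSpace.comap_mono
      ((generatedFiltration _ measurable_edgeSection_eval).mono (toDual_le_toDual.2 h)))

theorem comap_innovation_le (k : ℕ) :
    MeasurableSpace.comap (NoisyPath.innovation k) inferInstance ≤ noisyFiltration k := by
  refine measurable_iff_comap_le.1 (NoisyPath.measurable_innovation_of_le ?_ ?_)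
  · exact ((measurable_generatedFiltration EulerPath.measurable_edge le_rfl).comp
      (comap_measurable (m := eulerFiltration (toDual k)) Prod.fst)).mono le_sup_left le_rfl
  · exact ((measurable_generatedFiltration measurable_edgeSection_eval le_rfl).comp
      (comap_measurable (m := generatedFiltration (fun k (ω : ∀ k, EdgeSection k) => ω k)
      measurable_edgeSection_eval (toDual k)) Prod.snd)).mono le_sup_right le_rfl

/-- The joint law of a path and independent noise. -/
noncomputable def noisyLaw (μ : Measure EulerPath) [IsProbabilityMeasure μ] : Measure NoisyPath :=
  μ.prod (noiseLaw μ)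

instance (μ : Measure EulerPath) [IsProbabilityMeasure μ] : IsProbabilityMeasure (noisyLaw μ) := by
  unfold noisyLaw
  infer_instance

theorem map_fst_noisyLaw (μ : Measure EulerPath) [IsProbabilityMeasure μ] :
    (noisyLaw μ).map Prod.fst = μ := by
  simp [noisyLaw, Measure.map_fst_prod]

theorem noiseLaw_inter (μ : Measure EulerPath) [IsProbabilityMeasure μ] (k : ℕ)
    {D : Set (∀ k, EdgeSection k)}
    (hD : MeasurableSet[generatedFiltration (fun k (ω : ∀ k, EdgeSection k) => ω k)
      measurable_edgeSection_eval (toDual (k + 1))] D) (A : Set (EdgeSection k)) :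
    noiseLaw μ (D ∩ (fun ω => ω k) ⁻¹' A) = noiseLaw μ D * Measure.pi (edgeLaw μ k) A := by
  have hA : MeasurableSet A := A.to_countable.measurableSet
  have hi : iIndepFun (fun k (ω : ∀ k, EdgeSection k) => ω k) (noiseLaw μ) :=
    iIndepFun_infinitePi (X := fun k (s : EdgeSection k) => s) fun _ => measurable_id
  have h := indep_iSup_of_disjoint (S := {j | k + 1 ≤ j}) (T := {k})
    (fun j => (measurable_edgeSection_eval j).comap_le) hi.iIndep
    (Set.disjoint_singleton_right.2 (by simp))
  have h2 := (Indep_iff _ _ _).1 h D ((fun ω => ω k) ⁻¹' A) hD (by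
    refine (le_iSup₂_of_le (f := fun j (_ : j ∈ ({k} : Set ℕ)) => MeasurableSpace.comap
      (fun ω : ∀ k, EdgeSection k => ω j) inferInstance) k rfl le_rfl) _ ⟨A, hA, rfl⟩)
  rw [h2]
  congr 1
  rw [← Measure.map_apply (measurable_edgeSection_eval k) hA]
  exact congrArg (fun ν : Measure _ => ν A) (Measure.infinitePi_map_eval _ k)

/-- One step of the construction: the innovation is independent of the past. -/
theorem noisyLaw_prod_inter_innovation {lab : ∀ k, EulerEdge k → ℕ}
    (hlab : IsEdgeLabelling lab) {μ : Measure EulerPath} [IsProbabilityMeasure μ]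
    (hind : LabelsCondIndep lab μ) (k : ℕ) {B : Set EulerPath} {D : Set (∀ k, EdgeSection k)}
    (hB : MeasurableSet[eulerFiltration (toDual (k + 1))] B)
    (hD : MeasurableSet[generatedFiltration (fun k (ω : ∀ k, EdgeSection k) => ω k)
      measurable_edgeSection_eval (toDual (k + 1))] D) (s : EdgeSection k) :
    noisyLaw μ (B ×ˢ D ∩ NoisyPath.innovation k ⁻¹' {s})
      = noisyLaw μ (B ×ˢ D) * Measure.pi (edgeLaw μ k) {s} := by
  classical
  have hBm := eulerFiltration.le _ _ hB
  have hDm := (generatedFiltration _ measurable_edgeSection_eval).le _ _ hD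
  -- When the path passes through `w`, the innovation takes its coordinate `w` from the path and the
  -- others from the noise; the box leaves the noise free at `w`.
  let box : Fin (k + 2) → Set (EdgeSection k) := fun w =>
    Set.univ.pi (Function.update (fun w' => {s w'}) w Set.univ)
  let R : Fin (k + 2) → Set NoisyPath := fun w =>
    (B ∩ EulerPath.edge k ⁻¹' {(s w).1}) ×ˢ (D ∩ (fun ω => ω k) ⁻¹' box w)
  have hbox : ∀ (w : Fin (k + 2)) (s' : EdgeSection k), s' ∈ box w ↔ ∀ w', w' ≠ w → s' w' = s w' := by
    intro w s'
    simp only [box, Set.mem_univ_pi]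
    refine forall_congr' fun w' => ?_
    by_cases h : w' = w
    · subst h; simp
    · simp [h]
  have hunion : B ×ˢ D ∩ NoisyPath.innovation k ⁻¹' {s} = ⋃ w, R w := by
    ext ⟨γ, ω⟩
    have key : NoisyPath.innovation k (γ, ω) = s ↔
        γ.edge k = (s (γ.edge k).lower).1 ∧ ∀ w', w' ≠ (γ.edge k).lower → ω k w' = s w' := by
      simp only [NoisyPath.innovation, EdgeSection.replace, Function.update_eq_iff]
      refine and_congr_left fun _ => ?_
      exact Subtype.ext_iff
    simp only [Set.mem_inter_iff, Set.mem_prod, Set.mem_preimage, Set.mem_singleton_iff, key,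
      Set.mem_iUnion, R, hbox]
    constructor
    · rintro ⟨⟨h1, h2⟩, h3, h4⟩
      exact ⟨_, ⟨h1, h3⟩, h2, h4⟩
    · rintro ⟨w, ⟨h1, h3⟩, h2, h4⟩
      have hw : (γ.edge k).lower = w := by rw [h3, (s w).2]
      rw [hw]
      exact ⟨⟨h1, h2⟩, h3, h4⟩
  have hdisj : Pairwise (Function.onFun Disjoint R) := by
    intro w w' hne
    refine Set.disjoint_left.2 fun p hp hp' => hne ?_
    have h1 : p.1.edge k = (s w).1 := hp.1.2
    have h2 : p.1.edge k = (s w').1 := hp'.1.2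
    rw [← (s w).2, ← h1, h2, (s w').2]
  have hRm : ∀ w, MeasurableSet (R w) := fun w =>
    (hBm.inter (EulerPath.measurable_edge k (MeasurableSet.singleton _))).prod
      (hDm.inter (measurable_edgeSection_eval k (Set.to_countable _).measurableSet))
  -- The path supplies the missing factor at `w`. The product does not depend on `w`, hence the
  -- independence from the past.
  have hpi : ∀ w, edgeLaw μ k w {s w} * Measure.pi (edgeLaw μ k) (box w)
      = Measure.pi (edgeLaw μ k) {s} := by
    intro w
    rw [Measure.pi_pi, ← Set.univ_pi_singleton, Measure.pi_pi,
      ← Finset.mul_prod_erase Finset.univ _ (Finset.mem_univ w),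
      ← Finset.mul_prod_erase Finset.univ (fun i => edgeLaw μ k i {s i}) (Finset.mem_univ w)]
    simp only [Function.update_self, measure_univ, one_mul]
    congr 1
    refine Finset.prod_congr rfl fun i hi => ?_
    rw [Function.update_of_ne (Finset.ne_of_mem_erase hi)]
  have hB' : μ B = ∑ w, μ (B ∩ EulerPath.vertex (k + 1) ⁻¹' {w}) := by
    rw [← measure_biUnion_finset]
    · congr 1
      ext γ
      simp
    · intro w _ w' _ hne
      refine Set.disjoint_left.2 fun p hp hp' => hne (hp.2.symm.trans hp'.2)
    · intro w _
      exact hBm.inter (EulerPath.measurable_vertex _ (MeasurableSet.singleton w))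
  rw [hunion, measure_iUnion hdisj hRm, tsum_fintype]
  simp only [R, noisyLaw, Measure.prod_prod]
  rw [hB', Finset.sum_mul, Finset.sum_mul]
  refine Finset.sum_congr rfl fun w _ => ?_
  rw [hind.measure_inter_edge hlab k w (s w) hB, noiseLaw_inter μ k hD, ← hpi w]
  ring

theorem LabelsCondIndep.indep_innovation {lab : ∀ k, EulerEdge k → ℕ}
    (hlab : IsEdgeLabelling lab) {μ : Measure EulerPath} [IsProbabilityMeasure μ]
    (hind : LabelsCondIndep lab μ) (k : ℕ) :
    Indep (MeasurableSpace.comap (NoisyPath.innovation k) inferInstance)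
      (noisyFiltration (k + 1)) (noisyLaw μ) := by
  have hrect : ∀ {B : Set EulerPath} {D : Set (∀ k, EdgeSection k)},
      MeasurableSet[eulerFiltration (toDual (k + 1))] B →
      MeasurableSet[generatedFiltration (fun k (ω : ∀ k, EdgeSection k) => ω k)
        measurable_edgeSection_eval (toDual (k + 1))] D → ∀ T : Set (EdgeSection k),
      noisyLaw μ (B ×ˢ D ∩ NoisyPath.innovation k ⁻¹' T)
        = noisyLaw μ (B ×ˢ D) * Measure.pi (edgeLaw μ k) T := by
    intro B D hB hD T
    have hBD : MeasurableSet (B ×ˢ D) := (eulerFiltration.le _ _ hB).prod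
      ((generatedFiltration _ measurable_edgeSection_eval).le _ _ hD)
    have hT : MeasurableSet T := T.to_countable.measurableSet
    have heq : ((noisyLaw μ).restrict (B ×ˢ D)).map (NoisyPath.innovation k)
        = noisyLaw μ (B ×ˢ D) • Measure.pi (edgeLaw μ k) := by
      refine Measure.ext_of_singleton fun s => ?_
      rw [Measure.map_apply (NoisyPath.measurable_innovation k) (MeasurableSet.singleton s),
        Measure.restrict_apply (NoisyPath.measurable_innovation k (MeasurableSet.singleton s)),
        Set.inter_comm, noisyLaw_prod_inter_innovation hlab hind k hB hD]
      rfl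
    have := congrArg (fun ν : Measure _ => ν T) heq
    rw [Measure.map_apply (NoisyPath.measurable_innovation k) hT,
      Measure.restrict_apply (NoisyPath.measurable_innovation k hT), Set.inter_comm] at this
    exact this
  refine IndepSets.indep (NoisyPath.measurable_innovation k).comap_le (noisyFiltration_le _)
    (p1 := {t | MeasurableSet[MeasurableSpace.comap (NoisyPath.innovation k) inferInstance] t})
    (@MeasurableSpace.isPiSystem_measurableSet _
      (MeasurableSpace.comap (NoisyPath.innovation k) inferInstance))
    (isPiSystem_image2_inter (@MeasurableSpace.isPiSystem_measurableSet _
      ((eulerFiltration (toDual (k + 1))).comap Prod.fst))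
      (@MeasurableSpace.isPiSystem_measurableSet _
      ((generatedFiltration (fun k (ω : ∀ k, EdgeSection k) => ω k)
        measurable_edgeSection_eval (toDual (k + 1))).comap Prod.snd)))
    (@MeasurableSpace.generateFrom_measurableSet _
      (MeasurableSpace.comap (NoisyPath.innovation k) inferInstance)).symm
    (MeasurableSpace.sup_eq_generateFrom_image2_inter _ _) ?_
  refine (IndepSets_iff _ _ _).2 ?_
  rintro _ _ ⟨T, hT, rfl⟩ ⟨_, ⟨B, hB, rfl⟩, _, ⟨D, hD, rfl⟩, rfl⟩
  have h1 := hrect hB hD T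
  -- The trivial rectangle shows that the innovation has the product law.
  have h2 := hrect (B := Set.univ) (D := Set.univ) MeasurableSet.univ MeasurableSet.univ T
  simp only [Set.univ_prod_univ, Set.univ_inter, measure_univ, one_mul] at h2
  rw [← h2] at h1
  rw [Set.prod_eq] at h1
  rw [Set.inter_comm, h1, mul_comm]

/-- The last innovations are independent of the past of the path. -/
theorem LabelsCondIndep.indep_iSup_innovation {lab : ∀ k, EulerEdge k → ℕ}
    (hlab : IsEdgeLabelling lab) {μ : Measure EulerPath} [IsProbabilityMeasure μ]
    (hind : LabelsCondIndep lab μ) (N : ℕ) :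
    Indep (⨆ k, ⨆ _ : k < N, MeasurableSpace.comap (NoisyPath.innovation k) inferInstance)
      ((eulerFiltration (toDual N)).comap Prod.fst) (noisyLaw μ) :=
  indep_of_indep_of_le_right (indep_iSup_lt_of_indep_succ comap_innovation_le
    antitone_noisyFiltration noisyFiltration_le (hind.indep_innovation hlab) N) le_sup_left

/-! ## The flow of a sequence of sections -/

/-- The vertex at level `-k` which the section `s` connects to `w`. -/
def EdgeSection.step {k : ℕ} (s : EdgeSection k) (w : Fin (k + 2)) : Fin (k + 1) :=
  (s w).1.upper

/-- A step goes from `w` to `w` or `w - 1`; for `w < w'` the image of `w` is at most `w ≤ w' - 1`,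
which is at most the image of `w'`. -/
theorem EdgeSection.monotone_step {k : ℕ} (s : EdgeSection k) : Monotone s.step := by
  intro w w' h
  rcases h.eq_or_lt with rfl | h
  · exact le_rfl
  · have h1 := (s w).1.lower_eq_or
    have h2 := (s w').1.lower_eq_or
    rw [(s w).2] at h1
    rw [(s w').2] at h2
    change ((s w).1.upper : ℕ) ≤ (s w').1.upper
    have h' : (w : ℕ) < w' := h
    omega

theorem NoisyPath.vertex_eq_step (p : NoisyPath) (k : ℕ) :
    p.1.vertex k = (p.innovation k).step (p.1.vertex (k + 1)) := by
  rw [EdgeSection.step, p.innovation_vertex]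
  rfl

/-- Follow the sections `ω` from the vertex `x N` of level `-N`. -/
def sectionFlow (ω : ∀ k, EdgeSection k) (x : ∀ k, Fin (k + 1)) (N k : ℕ) : Fin (k + 1) :=
  if k < N then (ω k).step (sectionFlow ω x N (k + 1)) else x k
termination_by N - k

theorem sectionFlow_of_lt (ω : ∀ k, EdgeSection k) (x : ∀ k, Fin (k + 1)) {N k : ℕ} (h : k < N) :
    sectionFlow ω x N k = (ω k).step (sectionFlow ω x N (k + 1)) := by
  rw [sectionFlow, if_pos h]

theorem sectionFlow_of_le (ω : ∀ k, EdgeSection k) (x : ∀ k, Fin (k + 1)) {N k : ℕ} (h : N ≤ k) :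
    sectionFlow ω x N k = x k := by
  rw [sectionFlow, if_neg h.not_gt]

theorem sectionFlow_le_sectionFlow (ω : ∀ k, EdgeSection k) {x y : ∀ k, Fin (k + 1)} {N : ℕ}
    (h : x N ≤ y N) {k : ℕ} (hk : k ≤ N) : sectionFlow ω x N k ≤ sectionFlow ω y N k := by
  induction hk using Nat.decreasingInduction with
  | self => rwa [sectionFlow_of_le ω x le_rfl, sectionFlow_of_le ω y le_rfl]
  | of_succ k hk ih =>
    rw [sectionFlow_of_lt ω x hk, sectionFlow_of_lt ω y hk]
    exact (ω k).monotone_step ih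

theorem sectionFlow_congr (ω : ∀ k, EdgeSection k) {x y : ∀ k, Fin (k + 1)} {N : ℕ}
    (h : x N = y N) {k : ℕ} (hk : k ≤ N) : sectionFlow ω x N k = sectionFlow ω y N k :=
  le_antisymm (sectionFlow_le_sectionFlow ω h.le hk) (sectionFlow_le_sectionFlow ω h.ge hk)

theorem sectionFlow_eq_self {ω : ∀ k, EdgeSection k} {x : ∀ k, Fin (k + 1)}
    (h : ∀ k, x k = (ω k).step (x (k + 1))) {N k : ℕ} (hk : k ≤ N) :
    sectionFlow ω x N k = x k := by
  induction hk using Nat.decreasingInduction with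
  | self => exact sectionFlow_of_le ω x le_rfl
  | of_succ k hk ih => rw [sectionFlow_of_lt ω x hk, ih, ← h]

theorem measurable_sectionFlow {Ω : Type*} {m : MeasurableSpace Ω} {Y : ∀ k, Ω → EdgeSection k}
    (x : ∀ k, Fin (k + 1)) {N k : ℕ} (hk : k ≤ N)
    (hY : ∀ j, k ≤ j → j < N → Measurable (Y j)) :
    Measurable fun ω => sectionFlow (fun j => Y j ω) x N k := by
  induction hk using Nat.decreasingInduction with
  | self =>
    simp_rw [sectionFlow_of_le _ x le_rfl]
    exact measurable_const
  | of_succ k hk ih =>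
    simp_rw [sectionFlow_of_lt _ x hk]
    exact (measurable_of_countable fun z : EdgeSection k × Fin (k + 2) => z.1.step z.2).comp
      ((hY k le_rfl hk).prodMk (ih fun j hj => hY j (Nat.le_of_succ_le hj)))

/-- The vertex at level `-k` reached by following the innovations from the vertex `v` of
level `-N`. -/
def NoisyPath.vertexFrom (N : ℕ) (v : Fin (N + 1)) (k : ℕ) (p : NoisyPath) : Fin (k + 1) :=
  -- The value `0` away from `N` is irrelevant when `k ≤ N`.
  sectionFlow (fun j => p.innovation j) (Function.update (fun _ => 0) N v) N k

theorem NoisyPath.vertexFrom_vertex (p : NoisyPath) {N k : ℕ} (hk : k ≤ N) :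
    p.vertexFrom N (p.1.vertex N) k = p.1.vertex k := by
  rw [← sectionFlow_eq_self (NoisyPath.vertex_eq_step p) hk]
  exact sectionFlow_congr _ (by simp) hk

theorem NoisyPath.vertexFrom_mono (p : NoisyPath) {N k : ℕ} (hk : k ≤ N) {v w : Fin (N + 1)}
    (h : v ≤ w) : p.vertexFrom N v k ≤ p.vertexFrom N w k :=
  sectionFlow_le_sectionFlow _ (by simpa using h) hk

theorem NoisyPath.vertexFrom_of_lt (p : NoisyPath) {N k : ℕ} (hk : k < N) (v : Fin (N + 1)) :
    p.vertexFrom N v k = (p.innovation k).step (p.vertexFrom N v (k + 1)) :=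
  sectionFlow_of_lt _ _ hk

theorem NoisyPath.measurable_vertexFrom (N : ℕ) (v : Fin (N + 1)) {k : ℕ} (hk : k ≤ N) :
    Measurable (NoisyPath.vertexFrom N v k) :=
  measurable_sectionFlow _ hk fun j _ _ => NoisyPath.measurable_innovation j

/-- The trajectory from a fixed vertex uses only the innovations after `-N`, which are independent
of the past of the path. -/
theorem NoisyPath.measurable_vertexFrom_iSup (N : ℕ) (v : Fin (N + 1)) {k : ℕ} (hk : k ≤ N) :
    Measurable[⨆ k, ⨆ _ : k < N, MeasurableSpace.comap (NoisyPath.innovation k) inferInstance]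
      (NoisyPath.vertexFrom N v k) :=
  measurable_sectionFlow _ hk fun j _ hj => measurable_iff_comap_le.2
    (le_iSup₂_of_le (f := fun k (_ : k < N) =>
      MeasurableSpace.comap (NoisyPath.innovation k) inferInstance) j hj le_rfl)

/-! ### Coupling of trajectories and prediction of the path -/

section Coupling

variable {μ : Measure EulerPath} [IsProbabilityMeasure μ]

/-- The expected vertex at level `-k` from the vertex `v` of level `-N`. -/
noncomputable def meanVertex (μ : Measure EulerPath) [IsProbabilityMeasure μ] (N k : ℕ)
    (v : Fin (N + 1)) : ℝ :=
  ∫ p, (NoisyPath.vertexFrom N v k p : ℝ) ∂noisyLaw μ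

theorem measurable_fin_val_real (n : ℕ) : Measurable fun i : Fin n => (i : ℝ) :=
  measurable_from_top

theorem integrable_fin_val {Ω : Type*} [MeasurableSpace Ω] {P : Measure Ω} [IsFiniteMeasure P]
    {k : ℕ} {f : Ω → Fin (k + 1)} (hf : Measurable f) : Integrable (fun ω => (f ω : ℝ)) P := by
  refine Integrable.of_bound ((measurable_fin_val_real _).comp hf).aestronglyMeasurable k ?_
  refine ae_of_all _ fun ω => ?_
  simp only [Real.norm_natCast, Nat.cast_le]
  exact Fin.is_le _

/-- The monotone coupling. -/
theorem measureReal_vertexFrom_ne_le {N k : ℕ} (hk : k ≤ N) (v w : Fin (N + 1)) :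
    (noisyLaw μ).real {p | p.vertexFrom N v k ≠ p.vertexFrom N w k}
      ≤ |meanVertex μ N k v - meanVertex μ N k w| := by
  wlog h : v ≤ w generalizing v w
  · have := this w v (le_of_not_ge h)
    rw [abs_sub_comm] at this
    simpa only [ne_comm] using this
  have hv := NoisyPath.measurable_vertexFrom N v hk
  have hw := NoisyPath.measurable_vertexFrom N w hk
  have hm : MeasurableSet {p : NoisyPath | p.vertexFrom N v k ≠ p.vertexFrom N w k} :=
    (measurableSet_eq_fun hv hw).compl
  rw [abs_sub_comm]
  refine le_trans ?_ (le_abs_self _)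
  rw [meanVertex, meanVertex,
    ← integral_sub (integrable_fin_val hw) (integrable_fin_val hv), ← integral_indicator_one hm]
  refine integral_mono ((integrable_const 1).indicator hm)
    ((integrable_fin_val hw).sub (integrable_fin_val hv)) fun p => ?_
  have hle : (p.vertexFrom N v k : ℕ) ≤ p.vertexFrom N w k := p.vertexFrom_mono hk h
  -- Ordered integers that differ do so by at least one, so the indicator is bounded by the
  -- difference.
  by_cases hp : p.vertexFrom N v k = p.vertexFrom N w k
  · rw [Set.indicator_of_notMem (by simpa using hp)]
    simp [hp]
  · rw [Set.indicator_of_mem (by simpa using hp)]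
    have hlt : (p.vertexFrom N v k : ℕ) + 1 ≤ p.vertexFrom N w k :=
      Nat.succ_le_of_lt (lt_of_le_of_ne hle fun h => hp (Fin.ext h))
    have : ((p.vertexFrom N v k : ℕ) : ℝ) + 1 ≤ (p.vertexFrom N w k : ℕ) := by exact_mod_cast hlt
    simp only [Pi.one_apply]
    linarith

/-- Where the path is at `v` at level `-N`, it coincides afterwards with the trajectory from `v`,
which is independent of the past; its conditional mean is therefore its plain mean. -/
theorem LabelsCondIndep.condExp_vertex {lab : ∀ k, EulerEdge k → ℕ}
    (hlab : IsEdgeLabelling lab) (hind : LabelsCondIndep lab μ) {N k : ℕ} (hk : k ≤ N) :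
    μ[fun γ => (γ.vertex k : ℝ) | eulerFiltration (toDual N)]
      =ᵐ[μ] fun γ => meanVertex μ N k (γ.vertex N) := by
  have hmean : Measurable[eulerFiltration (toDual N)] fun γ : EulerPath =>
      meanVertex μ N k (γ.vertex N) :=
    (measurable_from_top (f := meanVertex μ N k)).comp
      (EulerPath.measurable_vertex_eulerFiltration le_rfl)
  have hmi : Integrable (fun γ : EulerPath => meanVertex μ N k (γ.vertex N)) μ := by
    have : Integrable (fun v => meanVertex μ N k v) (μ.map (EulerPath.vertex N)) :=
      Integrable.of_finite
    exact this.comp_measurable (EulerPath.measurable_vertex N)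
  refine (ae_eq_condExp_of_forall_setIntegral_eq (eulerFiltration.le _)
    (integrable_fin_val (EulerPath.measurable_vertex k)) (fun _ _ _ => hmi.integrableOn)
    (fun B hB _ => ?_) hmean.stronglyMeasurable.aestronglyMeasurable).symm
  have hBm := eulerFiltration.le _ _ hB
  let V : Fin (N + 1) → Set EulerPath := fun v => B ∩ EulerPath.vertex N ⁻¹' {v}
  have hVm : ∀ v, MeasurableSet (V v) := fun v =>
    hBm.inter (EulerPath.measurable_vertex N (MeasurableSet.singleton v))
  have hVd : Pairwise (Function.onFun Disjoint V) := fun v w hne =>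
    Set.disjoint_left.2 fun p hp hp' => hne (hp.2.symm.trans hp'.2)
  have hBV : B = ⋃ v, V v := by
    ext γ
    simp [V]
  rw [hBV, integral_iUnion hVm hVd hmi.integrableOn, integral_iUnion hVm hVd
    (integrable_fin_val (EulerPath.measurable_vertex k)).integrableOn, tsum_fintype, tsum_fintype]
  refine Finset.sum_congr rfl fun v _ => ?_
  have h1 : ∫ γ in V v, meanVertex μ N k (γ.vertex N) ∂μ = μ.real (V v) * meanVertex μ N k v := by
    rw [setIntegral_congr_fun (hVm v) (g := fun _ => meanVertex μ N k v)
      fun γ hγ => by rw [show γ.vertex N = v from hγ.2], setIntegral_const, smul_eq_mul]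
  have hmap : ∀ f : EulerPath → ℝ, AEStronglyMeasurable f μ →
      ∫ γ in V v, f γ ∂μ = ∫ p in Prod.fst ⁻¹' V v, f p.1 ∂noisyLaw μ := fun f hf => by
    conv_lhs => rw [← map_fst_noisyLaw μ]
    rw [setIntegral_map (hVm v) (by rwa [map_fst_noisyLaw]) measurable_fst.aemeasurable]
  have hV' : MeasurableSet[eulerFiltration (toDual N)] (V v) := MeasurableSet.inter hB
    (EulerPath.measurable_vertex_eulerFiltration le_rfl (MeasurableSet.singleton v))
  have h2 : ∫ p in Prod.fst ⁻¹' V v, (p.1.vertex k : ℝ) ∂noisyLaw μ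
      = ∫ p in Prod.fst ⁻¹' V v, (p.vertexFrom N v k : ℝ) ∂noisyLaw μ := by
    refine setIntegral_congr_fun (measurable_fst (hVm v)) fun p hp => ?_
    have hpv : p.1.vertex N = v := hp.2
    change (p.1.vertex k : ℝ) = p.vertexFrom N v k
    rw [← p.vertexFrom_vertex hk, hpv]
  have hfst : (eulerFiltration (toDual N)).comap Prod.fst
      ≤ (inferInstance : MeasurableSpace NoisyPath) :=
    (MeasurableSpace.comap_mono (eulerFiltration.le _)).trans le_sup_left
  have hA : (⨆ k, ⨆ _ : k < N, MeasurableSpace.comap (NoisyPath.innovation k) inferInstance)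
      ≤ (inferInstance : MeasurableSpace NoisyPath) :=
    iSup₂_le fun k _ => (NoisyPath.measurable_innovation k).comap_le
  have hvm := NoisyPath.measurable_vertexFrom_iSup N v hk
  have hsm : StronglyMeasurable[⨆ k, ⨆ _ : k < N,
      MeasurableSpace.comap (NoisyPath.innovation k) inferInstance]
      fun p : NoisyPath => (p.vertexFrom N v k : ℝ) :=
    ((measurable_fin_val_real _).comp hvm).stronglyMeasurable
  have h3 : ∫ p in Prod.fst ⁻¹' V v, (p.vertexFrom N v k : ℝ) ∂noisyLaw μ
      = (noisyLaw μ).real (Prod.fst ⁻¹' V v) * meanVertex μ N k v := by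
    have hpre : MeasurableSet[(eulerFiltration (toDual N)).comap (Prod.fst : NoisyPath → _)]
        (Prod.fst ⁻¹' V v) := ⟨V v, hV', rfl⟩
    rw [← setIntegral_condExp hfst (integrable_fin_val (NoisyPath.measurable_vertexFrom N v hk))
      hpre, setIntegral_congr_ae (hfst _ hpre) ((condExp_indep_eq hA hfst hsm
        (hind.indep_iSup_innovation hlab N)).mono fun _ h _ => h), setIntegral_const]
    rfl
  rw [h1, hmap (fun γ => (γ.vertex k : ℝ)) ((measurable_fin_val_real _).comp
    (EulerPath.measurable_vertex k)).aestronglyMeasurable, h2, h3]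
  congr 1
  rw [measureReal_def, measureReal_def, ← Measure.map_apply measurable_fst (hVm v),
    map_fst_noisyLaw]

/-- The mean distance between the prediction of the vertex at level `-k` at level `-N`, and its
expectation. -/
noncomputable def predictionError (μ : Measure EulerPath) [IsProbabilityMeasure μ] (N k : ℕ) : ℝ :=
  ∫ γ, |meanVertex μ N k (γ.vertex N) - ∫ γ', (γ'.vertex k : ℝ) ∂μ| ∂μ

theorem tendsto_predictionError {lab : ∀ k, EulerEdge k → ℕ}
    (hlab : IsEdgeLabelling lab) (hind : LabelsCondIndep lab μ) (herg : IsErgodicPathMeasure μ)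
    (k : ℕ) : Tendsto (fun N => predictionError μ N k) atTop (𝓝 0) := by
  have hmem : MemLp (fun γ : EulerPath => (γ.vertex k : ℝ)) 2 μ := by
    refine MemLp.of_bound ((measurable_fin_val_real _).comp
      (EulerPath.measurable_vertex k)).aestronglyMeasurable k (ae_of_all _ fun γ => ?_)
    simp only [Real.norm_natCast, Nat.cast_le]
    exact Fin.is_le _
  refine (IsKolmogorovian.tendsto_integral_abs_condExp_sub herg hmem).congr' ?_
  filter_upwards [eventually_ge_atTop k] with N hN
  refine integral_congr_ae ?_
  filter_upwards [hind.condExp_vertex hlab hN] with γ h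
  rw [h]

theorem integrable_comp_vertex (N : ℕ) (f : Fin (N + 1) → ℝ) :
    Integrable (fun γ : EulerPath => f (γ.vertex N)) μ :=
  (Integrable.of_finite (μ := μ.map (EulerPath.vertex N)) (f := f)).comp_measurable
    (EulerPath.measurable_vertex N)

/-- The vertex of the path at level `-N` is independent of the later innovations. Conditioning on
its value `w`, the coupling bounds each term by a difference of means, and the triangle inequality
through the limiting constant separates `v` from `w`. -/
theorem LabelsCondIndep.measureReal_vertexFrom_ne_vertex_le {lab : ∀ k, EulerEdge k → ℕ}
    (hlab : IsEdgeLabelling lab) (hind : LabelsCondIndep lab μ) {N k : ℕ} (hk : k ≤ N)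
    (v : Fin (N + 1)) :
    (noisyLaw μ).real {p | p.vertexFrom N v k ≠ p.1.vertex k}
      ≤ |meanVertex μ N k v - ∫ γ', (γ'.vertex k : ℝ) ∂μ| + predictionError μ N k := by
  set c := ∫ γ', (γ'.vertex k : ℝ) ∂μ with hc
  let V : Fin (N + 1) → Set NoisyPath := fun w => Prod.fst ⁻¹' (EulerPath.vertex N ⁻¹' {w})
  let D : Fin (N + 1) → Set NoisyPath := fun w => {p | p.vertexFrom N v k ≠ p.vertexFrom N w k}
  have hsub : {p : NoisyPath | p.vertexFrom N v k ≠ p.1.vertex k} ⊆ ⋃ w, D w ∩ V w := by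
    intro p hp
    refine Set.mem_iUnion.2 ⟨p.1.vertex N, ?_, rfl⟩
    change p.vertexFrom N v k ≠ p.vertexFrom N (p.1.vertex N) k
    rwa [p.vertexFrom_vertex hk]
  have hfac : ∀ w, (noisyLaw μ).real (D w ∩ V w)
      = (noisyLaw μ).real (D w) * μ.real (EulerPath.vertex N ⁻¹' {w}) := by
    intro w
    have hD : MeasurableSet[⨆ k, ⨆ _ : k < N,
        MeasurableSpace.comap (NoisyPath.innovation k) inferInstance] (D w) :=
      (measurableSet_eq_fun (NoisyPath.measurable_vertexFrom_iSup N v hk)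
        (NoisyPath.measurable_vertexFrom_iSup N w hk)).compl
    have h := (Indep_iff _ _ _).1 (hind.indep_iSup_innovation hlab N) (D w) (V w) hD
      ⟨_, EulerPath.measurable_vertex_eulerFiltration le_rfl (MeasurableSet.singleton w), rfl⟩
    rw [measureReal_def, h, ENNReal.toReal_mul, measureReal_def, measureReal_def]
    congr 2
    rw [← Measure.map_apply measurable_fst
      (EulerPath.measurable_vertex N (MeasurableSet.singleton w)), map_fst_noisyLaw]
  have hint : ∑ w, |meanVertex μ N k v - meanVertex μ N k w|
        * μ.real (EulerPath.vertex N ⁻¹' {w})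
      = ∫ γ, |meanVertex μ N k v - meanVertex μ N k (γ.vertex N)| ∂μ := by
    rw [← integral_map (μ := μ) (φ := EulerPath.vertex N)
      (f := fun w => |meanVertex μ N k v - meanVertex μ N k w|)
      (EulerPath.measurable_vertex N).aemeasurable (measurable_from_top.aestronglyMeasurable),
      integral_fintype Integrable.of_finite]
    refine Finset.sum_congr rfl fun w _ => ?_
    rw [measureReal_def, measureReal_def, Measure.map_apply (EulerPath.measurable_vertex N)
      (MeasurableSet.singleton w), smul_eq_mul, mul_comm]
  calc (noisyLaw μ).real {p | p.vertexFrom N v k ≠ p.1.vertex k}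
      ≤ (noisyLaw μ).real (⋃ w, D w ∩ V w) := measureReal_mono hsub
    _ ≤ ∑ w, (noisyLaw μ).real (D w ∩ V w) := measureReal_iUnion_fintype_le _
    _ ≤ ∑ w, |meanVertex μ N k v - meanVertex μ N k w| * μ.real (EulerPath.vertex N ⁻¹' {w}) := by
        refine Finset.sum_le_sum fun w _ => ?_
        rw [hfac w]
        exact mul_le_mul_of_nonneg_right (measureReal_vertexFrom_ne_le hk v w) measureReal_nonneg
    _ = ∫ γ, |meanVertex μ N k v - meanVertex μ N k (γ.vertex N)| ∂μ := hint
    _ ≤ ∫ γ, (|meanVertex μ N k v - c| + |meanVertex μ N k (γ.vertex N) - c|) ∂μ := by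
        refine integral_mono
          (integrable_comp_vertex N fun w => |meanVertex μ N k v - meanVertex μ N k w|)
          (integrable_comp_vertex N fun w =>
            |meanVertex μ N k v - c| + |meanVertex μ N k w - c|) fun γ => ?_
        rw [abs_sub_comm (meanVertex μ N k (γ.vertex N)) c]
        exact abs_sub_le _ _ _
    _ = |meanVertex μ N k v - c| + predictionError μ N k := by
        rw [integral_add (integrable_const _)
          (integrable_comp_vertex N fun w => |meanVertex μ N k w - c|)]
        simp [predictionError, hc]

/-- Some starting vertex predicts the last vertices of the path. -/
theorem LabelsCondIndep.exists_vertexFrom {lab : ∀ k, EulerEdge k → ℕ}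
    (hlab : IsEdgeLabelling lab) (hind : LabelsCondIndep lab μ) (herg : IsErgodicPathMeasure μ)
    (K : ℕ) {ε : ℝ} (hε : 0 < ε) :
    ∃ N, K ≤ N ∧ ∃ v : Fin (N + 1),
      (noisyLaw μ).real {p | ∃ k ≤ K, p.vertexFrom N v k ≠ p.1.vertex k} ≤ ε := by
  have hlim : Tendsto (fun N => ∑ k ∈ Finset.range (K + 1), predictionError μ N k) atTop (𝓝 0) := by
    simpa using tendsto_finsetSum (Finset.range (K + 1))
      fun k _ => tendsto_predictionError hlab hind herg k
  -- Half of `ε`, because the summed prediction error is paid twice: for the choice of `v` and for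
  -- the random vertex of the path.
  obtain ⟨N, hN, hKN⟩ := ((hlim.eventually_lt_const (half_pos hε)).and
    (eventually_ge_atTop K)).exists
  refine ⟨N, hKN, ?_⟩
  -- Some path does no worse than the average; its vertex at level `-N` serves for all `k ≤ K` at
  -- once.
  obtain ⟨γ, hγ⟩ := exists_le_integral (μ := μ) (integrable_comp_vertex N fun w =>
    ∑ k ∈ Finset.range (K + 1), |meanVertex μ N k w - ∫ γ', (γ'.vertex k : ℝ) ∂μ|)
  rw [integral_finsetSum _ fun k _ => integrable_comp_vertex N fun w =>
    |meanVertex μ N k w - ∫ γ', (γ'.vertex k : ℝ) ∂μ|] at hγ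
  refine ⟨γ.vertex N, ?_⟩
  have hset : {p : NoisyPath | ∃ k ≤ K, p.vertexFrom N (γ.vertex N) k ≠ p.1.vertex k}
      = ⋃ k ∈ Finset.range (K + 1), {p | p.vertexFrom N (γ.vertex N) k ≠ p.1.vertex k} := by
    ext p
    simp
  rw [hset]
  refine (measureReal_biUnion_finset_le _ _).trans ?_
  refine (Finset.sum_le_sum fun k hk => hind.measureReal_vertexFrom_ne_vertex_le hlab
    ((Nat.lt_succ_iff.1 (Finset.mem_range.1 hk)).trans hKN) (γ.vertex N)).trans ?_
  rw [Finset.sum_add_distrib]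
  have hγ' : ∑ k ∈ Finset.range (K + 1),
      |meanVertex μ N k (γ.vertex N) - ∫ γ', (γ'.vertex k : ℝ) ∂μ|
      ≤ ∑ k ∈ Finset.range (K + 1), predictionError μ N k := hγ
  linarith

/-- Almost surely, a suitable sequence of deterministic starting vertices predicts the path. -/
theorem LabelsCondIndep.exists_seq_eventually_vertexFrom_eq {lab : ∀ k, EulerEdge k → ℕ}
    (hlab : IsEdgeLabelling lab) (hind : LabelsCondIndep lab μ) (herg : IsErgodicPathMeasure μ) :
    ∃ (N : ℕ → ℕ) (v : ∀ j, Fin (N j + 1)), (∀ j, j ≤ N j) ∧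
      ∀ᵐ p ∂noisyLaw μ, ∀ k, ∀ᶠ j in atTop, p.vertexFrom (N j) (v j) k = p.1.vertex k := by
  -- The bounds `(1 / 2) ^ j` are summable, as Borel–Cantelli requires.
  choose N hN v hv using fun j : ℕ =>
    hind.exists_vertexFrom hlab herg j (ε := (1 / 2 : ℝ) ^ j) (by positivity)
  refine ⟨N, v, hN, ?_⟩
  have hsum : ∑' j, noisyLaw μ {p | ∃ k ≤ j, p.vertexFrom (N j) (v j) k ≠ p.1.vertex k} ≠ ⊤ := by
    refine ne_top_of_le_ne_top (summable_geometric_two.tsum_ofReal_ne_top)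
      (ENNReal.tsum_le_tsum fun j => ?_)
    rw [← ofReal_measureReal]
    exact ENNReal.ofReal_le_ofReal (hv j)
  filter_upwards [ae_eventually_notMem hsum] with p hp k
  filter_upwards [hp, eventually_ge_atTop k] with j hj hkj
  by_contra h
  exact hj ⟨k, hkj, h⟩

end Coupling

/-! ## Generating parameterizations -/

section Parameterization

variable {Ω : Type u} [mΩ : MeasurableSpace Ω] {P : Measure Ω} [IsProbabilityMeasure P]
  {F : BackwardFiltration Ω} {U : ℕ → Ω → ℝ} {hU : ∀ k, Measurable (U k)}

/-- A filtration is immersed in the filtration of a generating parameterization. -/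
theorem IsParameterization.isImmersed (h : IsParameterization F P U hU)
    (hle : F ≤ generatedFiltration U hU) : IsImmersed F (generatedFiltration U hU) P :=
  ⟨hle, fun k => condIndepSigma_of_indep (hle _) ((generatedFiltration U hU).le _)
    (hU k).comap_le (indep_of_indep_of_le_right (h k).1 le_sup_right) (h k).2⟩

/-- The variables of a parameterization are independent. -/
theorem IsParameterization.iIndepFun (h : IsParameterization F P U hU) : iIndepFun U P :=
  iIndep_of_indep_succ (H := fun k => generatedFiltration U hU (toDual k))
    (fun _ => comap_le_generatedFiltration hU le_rfl)
    (fun _ _ hij => (generatedFiltration U hU).mono (toDual_le_toDual.2 hij))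
    fun k => indep_of_indep_of_le_right (h k).1 le_sup_right

end Parameterization

theorem AdmitsGeneratingParameterization.isStandardFiltration {Ω : Type u} [MeasurableSpace Ω]
    {F : BackwardFiltration Ω} {P : Measure Ω} (h : AdmitsGeneratingParameterization F P) :
    IsStandardFiltration F P := by
  obtain ⟨Ω', mΩ', P', hP', F', U, hU, hiso, hpar, hle⟩ := h
  exact ⟨Ω', mΩ', P', hP', F', generatedFiltration U hU, hiso, ⟨U, hU, hpar.iIndepFun, rfl⟩,
    hpar.isImmersed hle⟩

/-! ## Real-valued innovations -/

/-- An encoding of the sections by real numbers. -/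
noncomputable def sectionCode (k : ℕ) (s : EdgeSection k) : ℝ :=
  ((exists_injective_nat (EdgeSection k)).choose s : ℝ)

theorem injective_sectionCode (k : ℕ) : Function.Injective (sectionCode k) :=
  Nat.cast_injective.comp (exists_injective_nat (EdgeSection k)).choose_spec

/-- The innovations, encoded by real numbers. -/
noncomputable def NoisyPath.code (k : ℕ) (p : NoisyPath) : ℝ := sectionCode k (p.innovation k)

theorem NoisyPath.measurable_code (k : ℕ) : Measurable (NoisyPath.code k) :=
  (measurable_of_countable (sectionCode k)).comp (NoisyPath.measurable_innovation k)

theorem NoisyPath.comap_code (k : ℕ) :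
    Real.measurableSpace.comap (NoisyPath.code k)
      = MeasurableSpace.comap (NoisyPath.innovation k) inferInstance := by
  refine le_antisymm ?_ ?_
  · exact measurable_iff_comap_le.1 ((measurable_of_countable (sectionCode k)).comp
      (comap_measurable (NoisyPath.innovation k)))
  · rintro _ ⟨T, -, rfl⟩
    refine ⟨sectionCode k '' T, (T.toFinite.image _).measurableSet, ?_⟩
    change NoisyPath.innovation k ⁻¹' (sectionCode k ⁻¹' (sectionCode k '' T)) = _
    rw [(injective_sectionCode k).preimage_image]

theorem NoisyPath.measurable_innovation_code {k m : ℕ} (h : k ≤ m) :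
    Measurable[generatedFiltration NoisyPath.code NoisyPath.measurable_code (toDual k)]
      (NoisyPath.innovation m) :=
  measurable_iff_comap_le.2 ((NoisyPath.comap_code m).symm.le.trans
    (comap_le_generatedFiltration NoisyPath.measurable_code h))

theorem generatedFiltration_code_le (k : ℕ) :
    generatedFiltration NoisyPath.code NoisyPath.measurable_code (toDual k) ≤ noisyFiltration k :=
  (generatedFiltration_le_iff NoisyPath.measurable_code).2 fun j hj =>
    (NoisyPath.comap_code j).le.trans
      ((comap_innovation_le j).trans (antitone_noisyFiltration hj))

/-! ## The path as a function of the innovations -/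

section Limit

variable (N : ℕ → ℕ) (v : ∀ j, Fin (N j + 1))

/-- The limit of the vertices at level `-k` reached from the vertices `v j`. -/
noncomputable def NoisyPath.limitVertex (k : ℕ) (p : NoisyPath) : Fin (k + 1) :=
  liminf (fun j => p.vertexFrom (N j) (v j) k) atTop

/-- The edge chosen by the innovation at the limit vertex. -/
noncomputable def NoisyPath.limitEdge (k : ℕ) (p : NoisyPath) : EulerEdge k :=
  (p.innovation k (p.limitVertex N v (k + 1))).1

variable {N}

/-- Monotone maps between finite chains commute with liminf. The identity thus holds at every point,
even where the trajectories do not converge. -/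
theorem NoisyPath.limitVertex_eq_step (hN : ∀ j, j ≤ N j) (k : ℕ) (p : NoisyPath) :
    p.limitVertex N v k = (p.innovation k).step (p.limitVertex N v (k + 1)) := by
  rw [NoisyPath.limitVertex, NoisyPath.limitVertex,
    (p.innovation k).monotone_step.map_liminf_of_continuousAt _
      continuous_of_discreteTopology.continuousAt]
  refine liminf_congr ?_
  filter_upwards [eventually_gt_atTop k] with j hj
  exact p.vertexFrom_of_lt (hj.trans_le (hN j)) (v j)

theorem NoisyPath.upper_limitEdge (hN : ∀ j, j ≤ N j) (k : ℕ) (p : NoisyPath) :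
    (p.limitEdge N v k).upper = p.limitVertex N v k :=
  (p.limitVertex_eq_step v hN k).symm

theorem NoisyPath.measurable_limitVertex (k : ℕ) :
    Measurable[generatedFiltration NoisyPath.code NoisyPath.measurable_code (toDual k)]
      (NoisyPath.limitVertex N v k) := by
  refine Measurable.liminf fun j => ?_
  -- Starting levels later than `-k` contribute only the constant default of the flow.
  rcases le_total k (N j) with h | h
  · exact measurable_sectionFlow _ h fun i hi _ => NoisyPath.measurable_innovation_code hi
  · have hconst : NoisyPath.vertexFrom (N j) (v j) k
        = fun _ => (Function.update (fun _ => 0) (N j) (v j) : ∀ k, Fin (k + 1)) k :=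
      funext fun _ => sectionFlow_of_le _ _ h
    rw [hconst]
    exact measurable_const

theorem NoisyPath.measurable_limitEdge_of {m : MeasurableSpace NoisyPath} {k : ℕ}
    (h₁ : Measurable[m] (NoisyPath.innovation k))
    (h₂ : Measurable[m] (NoisyPath.limitVertex N v (k + 1))) :
    Measurable[m] (NoisyPath.limitEdge N v k) :=
  (measurable_of_countable fun x : EdgeSection k × Fin (k + 2) => (x.1 x.2).1).comp
    (h₁.prodMk h₂)

theorem NoisyPath.measurable_limitEdge_code {k m : ℕ} (h : k ≤ m) :
    Measurable[generatedFiltration NoisyPath.code NoisyPath.measurable_code (toDual k)]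
      (NoisyPath.limitEdge N v m) :=
  NoisyPath.measurable_limitEdge_of v (NoisyPath.measurable_innovation_code h)
    ((NoisyPath.measurable_limitVertex v (m + 1)).mono
      ((generatedFiltration _ NoisyPath.measurable_code).mono
        (toDual_le_toDual.2 (h.trans (Nat.le_succ m)))) le_rfl)

theorem NoisyPath.measurable_limitEdge (k : ℕ) : Measurable (NoisyPath.limitEdge N v k) :=
  (NoisyPath.measurable_limitEdge_code v le_rfl).mono
    ((generatedFiltration _ NoisyPath.measurable_code).le _) le_rfl

theorem NoisyPath.limitVertex_eq_of_eventually {p : NoisyPath} {k : ℕ} {w : Fin (k + 1)}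
    (h : ∀ᶠ j in atTop, p.vertexFrom (N j) (v j) k = w) : p.limitVertex N v k = w :=
  (tendsto_nhds_of_eventually_eq h).liminf_eq

theorem limitEdge_le_generatedFiltration :
    generatedFiltration (NoisyPath.limitEdge N v) (NoisyPath.measurable_limitEdge v)
      ≤ generatedFiltration NoisyPath.code NoisyPath.measurable_code := fun k =>
  (generatedFiltration_le_iff (k := ofDual k) (NoisyPath.measurable_limitEdge v)).2 fun _ hj =>
    measurable_iff_comap_le.1 (NoisyPath.measurable_limitEdge_code v hj)

theorem LabelsCondIndep.isParameterization_code {lab : ∀ k, EulerEdge k → ℕ}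
    (hlab : IsEdgeLabelling lab) {μ : Measure EulerPath} [IsProbabilityMeasure μ]
    (hind : LabelsCondIndep lab μ) (hN : ∀ j, j ≤ N j) :
    IsParameterization
      (generatedFiltration (NoisyPath.limitEdge N v) (NoisyPath.measurable_limitEdge v))
      (noisyLaw μ) NoisyPath.code NoisyPath.measurable_code := by
  refine fun k => ⟨?_, ?_⟩
  · rw [NoisyPath.comap_code]
    exact indep_of_indep_of_le_right (hind.indep_innovation hlab k)
      ((sup_le (limitEdge_le_generatedFiltration v _) le_rfl).trans
        (generatedFiltration_code_le (k + 1)))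
  · refine (generatedFiltration_le_iff (NoisyPath.measurable_limitEdge v)).2 fun j hj => ?_
    rcases hj.eq_or_lt with rfl | hj
    · refine measurable_iff_comap_le.1 (NoisyPath.measurable_limitEdge_of v ?_ ?_)
      · exact measurable_iff_comap_le.2 ((NoisyPath.comap_code k).symm.le.trans le_sup_right)
      -- The limit vertex at `k + 1` is the upper end of the limit edge at `k + 1`, so it already
      -- belongs to the past of the copy.
      · have h := (measurable_from_top (f := EulerEdge.upper)).comp
          (measurable_generatedFiltration (NoisyPath.measurable_limitEdge v) (le_refl (k + 1)))
        have heq : NoisyPath.limitVertex N v (k + 1)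
            = EulerEdge.upper ∘ NoisyPath.limitEdge N v (k + 1) :=
          funext fun p => (p.upper_limitEdge v hN (k + 1)).symm
        rw [heq]
        exact h.mono le_sup_left le_rfl
    · exact (comap_le_generatedFiltration (NoisyPath.measurable_limitEdge v)
        (Nat.succ_le_of_lt hj)).trans le_sup_left

/-- Limit edges and path edges agree almost surely, so the two processes have the same law. -/
theorem isIsomorphicFiltration_limitEdge {μ : Measure EulerPath} [IsProbabilityMeasure μ]
    (h : ∀ᵐ p ∂noisyLaw μ, ∀ k, ∀ᶠ j in atTop, p.vertexFrom (N j) (v j) k = p.1.vertex k) :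
    IsIsomorphicFiltration eulerFiltration μ
      (generatedFiltration (NoisyPath.limitEdge N v) (NoisyPath.measurable_limitEdge v))
      (noisyLaw μ) := by
  refine ⟨EulerEdge, fun k => inferInstance, EulerPath.edge, NoisyPath.limitEdge N v,
    EulerPath.measurable_edge, NoisyPath.measurable_limitEdge v, rfl, rfl, ?_⟩
  conv_lhs => rw [← map_fst_noisyLaw μ]
  rw [Measure.map_map (measurable_pi_lambda _ EulerPath.measurable_edge) measurable_fst]
  refine Measure.map_congr ?_
  filter_upwards [h] with p hp
  funext k
  change p.1.edge k = NoisyPath.limitEdge N v k p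
  rw [NoisyPath.limitEdge, NoisyPath.limitVertex_eq_of_eventually v (hp (k + 1)),
    NoisyPath.innovation_vertex]

end Limit

theorem theorem7p3 (lab : ∀ k, EulerEdge k → ℕ) (hlab : IsEdgeLabelling lab)
    (μ : Measure EulerPath) [IsProbabilityMeasure μ]
    (herg : IsErgodicPathMeasure μ) (hind : LabelsCondIndep lab μ) :
    AdmitsGeneratingParameterization eulerFiltration μ ∧
      IsStandardFiltration eulerFiltration μ := by
  obtain ⟨N, v, hN, h⟩ := hind.exists_seq_eventually_vertexFrom_eq hlab herg
  have hgen : AdmitsGeneratingParameterization eulerFiltration μ :=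
    ⟨NoisyPath, inferInstance, noisyLaw μ, inferInstance,
      generatedFiltration (NoisyPath.limitEdge N v) (NoisyPath.measurable_limitEdge v),
      NoisyPath.code, NoisyPath.measurable_code, isIsomorphicFiltration_limitEdge v h,
      hind.isParameterization_code v hlab hN, limitEdge_le_generatedFiltration v⟩
  exact ⟨hgen, hgen.isStandardFiltration⟩
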